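/- Let $M$ be a smooth surface and let $\mathcal A\subset TM\setminus 0$ be a conic sub-bundle, i.e. a non-empty open set of non-zero tangent vectors that is invariant under positive scaling and projects onto $M$. Write $(x^i,y^i)$ for natural coordinates of $TM$, $\partial_i=\partial/\partial x^i$, $\dot\partial_i=\partial/\partial y^i$. Let $F:\mathcal A\to\mathbb R$ be a conic pseudo-Finsler metric: $F$ is smooth, positively homogeneous of degree $1$ in $y$, and $g_{ij}=\frac12\dot\partial_i\dot\partial_jF^2$ is non-degenerate on $\mathcal A$ (so $F\neq0$ there). Put - $\varepsilon=\operatorname{sign}\det(g_{ij})=\pm1$, $\ell_i=\dot\partial_iF$, $\ell^i=y^i/F$, $(m^1,m^2)=\frac{\varepsilon}{\sqrt{\varepsilon\det(g_{ij})}}(-\ell_2,\ell_1)$ and $m_i=g_{ij}m^j$, so that $g_{ij}=\ell_i\ell_j+\varepsilon m_im_j$; - $C_{ijk}=\frac12\dot\partial_kg_{ij}$ (the Cartan tensor), and $\mathcal I$ (the main scalar) defined by $F\,C_{ijk}=\mathcal I\,m_im_jm_k$; - $G^i=\frac14g^{ih}(y^r\partial_r\dot\partial_hF^2-\partial_hF^2)$,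 the coefficients of the geodesic spray $S=y^i\partial_i-2G^i\dot\partial_i$, and $G^i_j=\dot\partial_jG^i$, $\delta_i=\partial_i-G^j_i\dot\partial_j$; - for a function $f$: $f_{;2}=\varepsilon F(\dot\partial_if)m^i$, $f_{,1}=(\delta_if)\ell^i$, $f_{,2}=\varepsilon(\delta_if)m^i$; successive indices denote successive derivatives from left to right, e.g. $f_{,1;2}=(f_{,1})_{;2}$. A metric is called Berwaldian if its Berwald curvature $G^h_{ijk}=\dot\partial_k\dot\partial_j\dot\partial_iG^h$ vanishes on $\mathcal A$, and pseudo-Riemannian if $C_{ijk}=0$ on $\mathcal A$. Assume that $F$ is pseudo-Riemannian, and let $\overline F=e^{\phi}F$ be an anisotropic conformal change of $F$: $\phi$ is a smooth function on $\mathcal A$, positively homogeneous of degree $0$ in $y$, with $F^2(\dot\partial_i\dot\partial_j\phi+(\dot\partial_i\phi)(\dot\partial_j\phi))m^im^j+\varepsilon\neq0$ on $\mathcal A$. Put $$\sigma=\phi_{;2;2}+\varepsilon\mathcal I\phi_{;2}+2(\phi_{;2})^2,\qquad \rho=\frac1{\sigma+\varepsilon-(\phi_{;2})^2},$$ $$2Q=\varepsilon\rho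 F^2(\phi_{;2}\phi_{,1}+\phi_{,1;2}-2\phi_{,2}),\qquad 2P=-\rho F^2\phi_{;2}(\phi_{;2}\phi_{,1}+\phi_{,1;2}-2\phi_{,2})+F^2\phi_{,1}.$$ Then $\overline F$ is Berwaldian if and only if, on $\mathcal A$, $$-3\varepsilon Q-3Q_{;2;2}+\varepsilon P_{;2}+P_{;2;2;2}=0\quad\text{and}\quad 3P+3\varepsilon P_{;2;2}+\varepsilon Q_{;2}+Q_{;2;2;2}=0 .$$ Moreover, if the geodesic sprays $S$ of $F$ and $\overline S$ of $\overline F$ are projectively equivalent, i.e. $\overline G^i=G^i+\lambda y^i$ on $\mathcal A$ for some function $\lambda$ on $\mathcal A$, then $\overline F$ is Berwaldian if and only if $\phi_{,1}+\varepsilon\phi_{,1;2;2}=0$ on $\mathcal A$. (In natural coordinates of overlapping charts, $m^i$ is determined up to sign; the conditions above do not depend on this sign.) -/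

import Mathlib

open scoped Manifold ContDiff

namespace ConicFinsler

/-- The coordinate plane `ℝ²`. -/
abbrev Plane : Type := EuclideanSpace ℝ (Fin 2)

/-! ### Calculus in natural coordinates `(x, y)` of the tangent bundle of a surface

A point is `z = (x, y)` with position `x = z.1` and direction `y = z.2`. All functions below are
meant on the open set of `ℝ² × ℝ²` where the metric function `F` is given. -/

noncomputable section Coordinates

/-- `∂ᵢ f = ∂f/∂xⁱ`. -/
def dx (i : Fin 2) (f : Plane × Plane → ℝ) (z : Plane × Plane) : ℝ :=
  fderiv ℝ f z (EuclideanSpace.single i 1, 0)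

/-- `∂̇ᵢ f = ∂f/∂yⁱ`. -/
def dy (i : Fin 2) (f : Plane × Plane → ℝ) (z : Plane × Plane) : ℝ :=
  fderiv ℝ f z (0, EuclideanSpace.single i 1)

/-- The Finsler metric tensor `gᵢⱼ = ½ ∂̇ᵢ ∂̇ⱼ F²`. -/
def metricTensor (F : Plane × Plane → ℝ) (i j : Fin 2) (z : Plane × Plane) : ℝ :=
  1 / 2 * dy i (dy j (fun w => F w ^ 2)) z

/-- The matrix `(gᵢⱼ)`. -/
def metricMatrix (F : Plane × Plane → ℝ) (z : Plane × Plane) : Matrix (Fin 2) (Fin 2) ℝ :=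
  Matrix.of fun i j => metricTensor F i j z

/-- The Cartan tensor `Cᵢⱼₖ = ½ ∂̇ₖ gᵢⱼ`. -/
def cartanTensor (F : Plane × Plane → ℝ) (i j k : Fin 2) (z : Plane × Plane) : ℝ :=
  1 / 2 * dy k (metricTensor F i j) z

/-- The signature `ε = sign (det g) = ±1`. -/
def eps (F : Plane × Plane → ℝ) (z : Plane × Plane) : ℝ :=
  Real.sign (metricMatrix F z).det

/-- `ℓᵢ = ∂̇ᵢ F`. -/
def ellLow (F : Plane × Plane → ℝ) (i : Fin 2) (z : Plane × Plane) : ℝ :=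
  dy i F z

/-- `ℓⁱ = yⁱ / F`. -/
def ellUp (F : Plane × Plane → ℝ) (i : Fin 2) (z : Plane × Plane) : ℝ :=
  z.2 i / F z

/-- The second vector of the modified Berwald frame:
`(m¹, m²) = ε / √(ε det g) • (-ℓ₂, ℓ₁)`. -/
def mUp (F : Plane × Plane → ℝ) (i : Fin 2) (z : Plane × Plane) : ℝ :=
  eps F z / Real.sqrt (eps F z * (metricMatrix F z).det)
    * (![-ellLow F 1 z, ellLow F 0 z] : Fin 2 → ℝ) i

/-- The main scalar `𝓘`, given by `F Cᵢⱼₖ = 𝓘 mᵢ mⱼ mₖ`, that is, as `mⁱ mᵢ = ε = ±1`,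
`𝓘 = ε F Cᵢⱼₖ mⁱ mʲ mᵏ`. -/
def mainScalar (F : Plane × Plane → ℝ) (z : Plane × Plane) : ℝ :=
  eps F z * F z *
    ∑ i, ∑ j, ∑ k, cartanTensor F i j k z * mUp F i z * mUp F j z * mUp F k z

/-- The coefficients `Gⁱ = ¼ gⁱʰ (yʳ ∂ᵣ ∂̇ₕ F² - ∂ₕ F²)` of the geodesic spray
`S = yⁱ ∂ᵢ - 2 Gⁱ ∂̇ᵢ` of `F`. -/
def sprayCoeff (F : Plane × Plane → ℝ) (i : Fin 2) (z : Plane × Plane) : ℝ :=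
  1 / 4 * ∑ h, (metricMatrix F z)⁻¹ i h *
    ((∑ r, z.2 r * dx r (dy h (fun w => F w ^ 2)) z) - dx h (fun w => F w ^ 2) z)

/-- The coefficients `Gⁱⱼ = ∂̇ⱼ Gⁱ` of the Barthel connection. -/
def barthel (F : Plane × Plane → ℝ) (i j : Fin 2) (z : Plane × Plane) : ℝ :=
  dy j (sprayCoeff F i) z

/-- The coefficients `Gⁱⱼₖ = ∂̇ₖ Gⁱⱼ` of the Berwald connection. -/
def berwaldConnection (F : Plane × Plane → ℝ) (i j k : Fin 2) (z : Plane × Plane) : ℝ :=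
  dy k (barthel F i j) z

/-- The Berwald curvature `Gⁱⱼₖᵣ = ∂̇ᵣ Gⁱⱼₖ`. -/
def berwaldCurvature (F : Plane × Plane → ℝ) (i j k r : Fin 2) (z : Plane × Plane) : ℝ :=
  dy r (berwaldConnection F i j k) z

/-- The horizontal derivative `δᵢ f = ∂ᵢ f - Gʲᵢ ∂̇ⱼ f`. -/
def delta (F : Plane × Plane → ℝ) (i : Fin 2) (f : Plane × Plane → ℝ) (z : Plane × Plane) : ℝ :=
  dx i f z - ∑ j, barthel F j i z * dy j f z

/-- The v-scalar derivative `f_{;2} = ε F (∂̇ᵢ f) mⁱ`. -/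
def vDeriv2 (F f : Plane × Plane → ℝ) (z : Plane × Plane) : ℝ :=
  eps F z * F z * ∑ i, dy i f z * mUp F i z

/-- The h-scalar derivative `f_{,1} = (δᵢ f) ℓⁱ`. -/
def hDeriv1 (F f : Plane × Plane → ℝ) (z : Plane × Plane) : ℝ :=
  ∑ i, delta F i f z * ellUp F i z

/-- The h-scalar derivative `f_{,2} = ε (δᵢ f) mⁱ`. -/
def hDeriv2 (F f : Plane × Plane → ℝ) (z : Plane × Plane) : ℝ :=
  eps F z * ∑ i, delta F i f z * mUp F i z

/-- `F² (∂̇ᵢ ∂̇ⱼ φ + (∂̇ᵢ φ) (∂̇ⱼ φ)) mⁱ mʲ + ε`, whose non-vanishing is required of an anisotropic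
conformal change. -/
def changeFactor (F φ : Plane × Plane → ℝ) (z : Plane × Plane) : ℝ :=
  F z ^ 2 * (∑ i, ∑ j, (dy i (dy j φ) z + dy i φ z * dy j φ z) * mUp F i z * mUp F j z)
    + eps F z

/-- `σ = φ_{;2;2} + ε 𝓘 φ_{;2} + 2 (φ_{;2})²`. -/
def sigma (F φ : Plane × Plane → ℝ) (z : Plane × Plane) : ℝ :=
  vDeriv2 F (vDeriv2 F φ) z + eps F z * mainScalar F z * vDeriv2 F φ z + 2 * vDeriv2 F φ z ^ 2

/-- `ρ = 1 / (σ + ε - (φ_{;2})²)`. -/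
def rho (F φ : Plane × Plane → ℝ) (z : Plane × Plane) : ℝ :=
  1 / (sigma F φ z + eps F z - vDeriv2 F φ z ^ 2)

/-- `Q`, given by `2 Q = ε ρ F² (φ_{;2} φ_{,1} + φ_{,1;2} - 2 φ_{,2})`. -/
def Q (F φ : Plane × Plane → ℝ) (z : Plane × Plane) : ℝ :=
  1 / 2 * (eps F z * rho F φ z * F z ^ 2 *
    (vDeriv2 F φ z * hDeriv1 F φ z + vDeriv2 F (hDeriv1 F φ) z - 2 * hDeriv2 F φ z))

/-- `P`, given by
`2 P = - ρ F² φ_{;2} (φ_{;2} φ_{,1} + φ_{,1;2} - 2 φ_{,2}) + F² φ_{,1}`. -/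
def P (F φ : Plane × Plane → ℝ) (z : Plane × Plane) : ℝ :=
  1 / 2 * (-(rho F φ z * F z ^ 2 * vDeriv2 F φ z *
    (vDeriv2 F φ z * hDeriv1 F φ z + vDeriv2 F (hDeriv1 F φ) z - 2 * hDeriv2 F φ z))
    + F z ^ 2 * hDeriv1 F φ z)

end Coordinates

/-! ### Conic pseudo-Finsler surfaces -/

noncomputable section Surface

variable {M : Type*} [TopologicalSpace M] [ChartedSpace Plane M]

/-- The tangent vector of `M` with natural coordinates `(x, y)` with respect to the chart `e`:
the vector `yⁱ ∂/∂xⁱ` at the point with coordinates `x`. -/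
def tangentPoint (e : OpenPartialHomeomorph M Plane) (z : Plane × Plane) :
    TangentBundle 𝓘(ℝ, Plane) M :=
  ⟨e.symm z.1, mfderiv 𝓘(ℝ, Plane) 𝓘(ℝ, Plane) e.symm z.1 z.2⟩

/-- A function on the tangent bundle in the natural coordinates of the chart `e`. -/
def inCoord (e : OpenPartialHomeomorph M Plane) (f : TangentBundle 𝓘(ℝ, Plane) M → ℝ)
    (z : Plane × Plane) : ℝ :=
  f (tangentPoint e z)

/-- The part of `𝒜` over the domain of the chart `e`, in natural coordinates. -/
def coordDomain (e : OpenPartialHomeomorph M Plane) (𝒜 : Set (TangentBundle 𝓘(ℝ, Plane) M)) :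
    Set (Plane × Plane) :=
  {z | z.1 ∈ e.target ∧ tangentPoint e z ∈ 𝒜}

/-- `p z` holds at every point of `𝒜` in the natural coordinates `z = (x, y)` of every smooth
chart of `M`; the property may use the chart `e`. -/
def EverywhereInCoord (𝒜 : Set (TangentBundle 𝓘(ℝ, Plane) M))
    (p : OpenPartialHomeomorph M Plane → Plane × Plane → Prop) : Prop :=
  ∀ e ∈ IsManifold.maximalAtlas 𝓘(ℝ, Plane) ∞ M, ∀ z ∈ coordDomain e 𝒜, p e z

/-- A conic sub-bundle of `TM`: a non-empty open set of non-zero tangent vectors, invariant under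
positive scaling, that projects onto `M`. -/
structure IsConicSubbundle [IsManifold 𝓘(ℝ, Plane) ∞ M]
    (𝒜 : Set (TangentBundle 𝓘(ℝ, Plane) M)) : Prop where
  nonempty : 𝒜.Nonempty
  isOpen : IsOpen 𝒜
  ne_zero : ∀ u ∈ 𝒜, u.2 ≠ 0
  smul_mem : ∀ u ∈ 𝒜, ∀ c : ℝ, 0 < c → (⟨u.1, c • u.2⟩ : TangentBundle 𝓘(ℝ, Plane) M) ∈ 𝒜
  surjective : ∀ x : M, ∃ u ∈ 𝒜, u.1 = x

/-- `f` is positively homogeneous of degree `r` in the direction on `𝒜`. -/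
def IsPosHomogeneous (𝒜 : Set (TangentBundle 𝓘(ℝ, Plane) M)) (r : ℕ)
    (f : TangentBundle 𝓘(ℝ, Plane) M → ℝ) : Prop :=
  ∀ u ∈ 𝒜, ∀ c : ℝ, 0 < c → f ⟨u.1, c • u.2⟩ = c ^ r * f u

/-- `f` is smooth on `𝒜`. -/
def IsSmoothOn [IsManifold 𝓘(ℝ, Plane) ∞ M] (𝒜 : Set (TangentBundle 𝓘(ℝ, Plane) M))
    (f : TangentBundle 𝓘(ℝ, Plane) M → ℝ) : Prop :=
  ContMDiffOn 𝓘(ℝ, Plane).tangent 𝓘(ℝ, ℝ) ∞ f 𝒜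

/-- `F` is a conic pseudo-Finsler metric on the surface `M`, defined on `𝒜`. Its values outside
`𝒜` play no role. -/
structure IsConicPseudoFinsler [IsManifold 𝓘(ℝ, Plane) ∞ M]
    (𝒜 : Set (TangentBundle 𝓘(ℝ, Plane) M)) (F : TangentBundle 𝓘(ℝ, Plane) M → ℝ) : Prop where
  subbundle : IsConicSubbundle 𝒜
  smooth : IsSmoothOn 𝒜 F
  homogeneous : IsPosHomogeneous 𝒜 1 F
  nondegenerate : EverywhereInCoord 𝒜 fun e z => (metricMatrix (inCoord e F) z).det ≠ 0

/-- `F` is pseudo-Riemannian on `𝒜`: the metric tensor does not depend on the direction, that is,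
the Cartan tensor vanishes. -/
def IsPseudoRiemannian (𝒜 : Set (TangentBundle 𝓘(ℝ, Plane) M))
    (F : TangentBundle 𝓘(ℝ, Plane) M → ℝ) : Prop :=
  EverywhereInCoord 𝒜 fun e z => ∀ i j k, cartanTensor (inCoord e F) i j k z = 0

/-- `F` is Berwaldian on `𝒜`: its Berwald curvature vanishes. -/
def IsBerwald (𝒜 : Set (TangentBundle 𝓘(ℝ, Plane) M))
    (F : TangentBundle 𝓘(ℝ, Plane) M → ℝ) : Prop :=
  EverywhereInCoord 𝒜 fun e z => ∀ i j k r, berwaldCurvature (inCoord e F) i j k r z = 0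

/-- `φ` is the factor of an anisotropic conformal change of `F`. -/
structure IsAnisotropicFactor [IsManifold 𝓘(ℝ, Plane) ∞ M]
    (𝒜 : Set (TangentBundle 𝓘(ℝ, Plane) M)) (F φ : TangentBundle 𝓘(ℝ, Plane) M → ℝ) : Prop where
  smooth : IsSmoothOn 𝒜 φ
  homogeneous : IsPosHomogeneous 𝒜 0 φ
  changeFactor_ne_zero : EverywhereInCoord 𝒜 fun e z =>
    changeFactor (inCoord e F) (inCoord e φ) z ≠ 0

/-- The anisotropic conformal change `F̄ = e^φ F`. -/
def conformalChange (F φ : TangentBundle 𝓘(ℝ, Plane) M → ℝ) :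
    TangentBundle 𝓘(ℝ, Plane) M → ℝ :=
  fun u => Real.exp (φ u) * F u

/-- The geodesic sprays `S` of `F` and `S'` of `F'` are projectively equivalent on `𝒜`:
`S' = S - 2 λ C` with `C = yⁱ ∂̇ᵢ` and a function `λ` on `𝒜`, that is, `G'ⁱ = Gⁱ + λ yⁱ`.
As `y ≠ 0` on `𝒜`, such a `λ` is automatically smooth and positively homogeneous of degree one. -/
def ProjectivelyEquivalent (𝒜 : Set (TangentBundle 𝓘(ℝ, Plane) M))
    (F F' : TangentBundle 𝓘(ℝ, Plane) M → ℝ) : Prop :=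
  ∃ lam : TangentBundle 𝓘(ℝ, Plane) M → ℝ, EverywhereInCoord 𝒜 fun e z =>
    ∀ i, sprayCoeff (inCoord e F') i z = sprayCoeff (inCoord e F) i z + inCoord e lam z * z.2 i

end Surface

end ConicFinsler

/-! The statement is local. In a chart the vanishing Cartan tensor makes g independent of y, so W =
F²/2 and the spray coefficients Gⁱ are quadratic in y and the third vertical derivatives of Gⁱ
vanish (`eee_G`). If the spray coefficients of e^φ F are Gⁱ + Tⁱ, its Berwald curvature is therefore
the third vertical derivative of T alone. The formula T = Q m + P ℓ is `Factor.spray_Wbar`: the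
linear system that defines the new spray is tested on the frame y, v, where v = εFm.

Each Tⁱ is homogeneous of degree two, so its third derivative is a symmetric cubic form annihilated
by y. In dimension two such a form is determined by its value on (v, v, v) (`cubic_eq_zero`), which
equals D³Tⁱ + 4εDTⁱ for D = vⁱ∂̇ᵢ, the derivative f ↦ f_{;2} (`vvv_eq`). Since DF = 0, Dy = v and Dv
= -εy, D acts on the coefficients of a combination of y and v by a first-order operator with
constant coefficients. Applying it to (Q, P) gives exactly the two stated expressions
(`Factor.F_vvv_T`).

If the sprays are projectively equivalent, T is a multiple of y, so Q = 0 and 2P = F²φ_{,1}. With X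
= φ_{,1} + εφ_{,1;2;2} the two expressions become nonzero multiples of F²X and F²DX, so X = 0
suffices.

The computations are identities in an abstract ℝ-algebra with derivations ∂ᵢ and ∂̇ᵢ
(`RiemannCalculus`). Smooth functions on an open set where sign det g is constant realize it, and
`Represents` links its elements to the pointwise definitions. -/

namespace ConicFinsler

/-! ### Smooth functions on an open set and their directional derivatives -/

noncomputable section

/-- The algebra of smooth real functions on a set `V` of a normed space. -/
def smoothFunctions {E : Type*} [NormedAddCommGroup E] [NormedSpace ℝ E] (V : Set E) :
    Subalgebra ℝ (V → ℝ) where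
  carrier := {a | ∃ f : E → ℝ, ContDiffOn ℝ ∞ f V ∧ ∀ z : V, f z = a z}
  mul_mem' := by
    rintro a b ⟨f, hf, hfa⟩ ⟨g, hg, hgb⟩
    exact ⟨fun z => f z * g z, hf.mul hg, fun z => by simp [hfa, hgb]⟩
  add_mem' := by
    rintro a b ⟨f, hf, hfa⟩ ⟨g, hg, hgb⟩
    exact ⟨fun z => f z + g z, hf.add hg, fun z => by simp [hfa, hgb]⟩
  algebraMap_mem' r := ⟨fun _ => r, contDiffOn_const, fun z => by simp⟩

section

variable {E : Type*} [NormedAddCommGroup E] [NormedSpace ℝ E] {V : Set E}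

/-- `f` agrees on `V` with the smooth function `a`. -/
def Represents (f : E → ℝ) (a : smoothFunctions V) : Prop := ∀ z : V, f z = a.1 z

/-- A smooth extension of a function on `V`. -/
def smoothExt (a : smoothFunctions V) : E → ℝ := Classical.choose a.2

lemma contDiffOn_smoothExt (a : smoothFunctions V) : ContDiffOn ℝ ∞ (smoothExt a) V :=
  (Classical.choose_spec a.2).1

lemma represents_smoothExt (a : smoothFunctions V) : Represents (smoothExt a) a :=
  (Classical.choose_spec a.2).2

lemma Represents.eqOn {f g : E → ℝ} {a : smoothFunctions V} (hf : Represents f a)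
    (hg : Represents g a) : Set.EqOn f g V := fun z hz => (hf ⟨z, hz⟩).trans (hg ⟨z, hz⟩).symm

/-- On an open set the derivative depends only on the germ, so derivatives of elements of
`smoothFunctions V` do not depend on the chosen extension. -/
lemma Represents.fderiv_eq {f g : E → ℝ} {a : smoothFunctions V} (hV : IsOpen V)
    (hf : Represents f a) (hg : Represents g a) {z : E} (hz : z ∈ V) :
    fderiv ℝ f z = fderiv ℝ g z :=
  ((hf.eqOn hg).eventuallyEq_of_mem (hV.mem_nhds hz)).fderiv_eq

lemma differentiableAt_smoothExt (hV : IsOpen V) (a : smoothFunctions V) {z : E} (hz : z ∈ V) :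
    DifferentiableAt ℝ (smoothExt a) z :=
  ((contDiffOn_smoothExt a).contDiffAt (hV.mem_nhds hz)).differentiableAt (by simp)

/-- The restriction to `V` of a function that is smooth on `V`. -/
def mkSmooth (f : E → ℝ) (hf : ContDiffOn ℝ ∞ f V) : smoothFunctions V :=
  ⟨fun z => f z, f, hf, fun _ => rfl⟩

lemma represents_mkSmooth (f : E → ℝ) (hf : ContDiffOn ℝ ∞ f V) :
    Represents f (mkSmooth f hf) := fun _ => rfl

/-- The derivative in the direction `u`, as a derivation of the algebra of smooth functions. -/
def directional (hV : IsOpen V) (u : E) :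
    Derivation ℝ (smoothFunctions V) (smoothFunctions V) :=
  Derivation.mk'
    { toFun := fun a => mkSmooth (fun z => fderiv ℝ (smoothExt a) z u)
        (((contDiffOn_smoothExt a).fderiv_of_isOpen hV (by simp)).clm_apply contDiffOn_const)
      map_add' := fun a b => by
        ext z
        have h : Represents (fun w => smoothExt a w + smoothExt b w) (a + b) := fun w => by
          simp [represents_smoothExt a w, represents_smoothExt b w]
        have := (represents_smoothExt (a + b)).fderiv_eq hV h z.2
        simp only [mkSmooth, this]
        rw [fderiv_fun_add (differentiableAt_smoothExt hV a z.2) (differentiableAt_smoothExt hV b z.2)]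
        rfl
      map_smul' := fun c a => by
        ext z
        have h : Represents (fun w => c * smoothExt a w) (c • a) := fun w => by
          simp [represents_smoothExt a w]
        have := (represents_smoothExt (c • a)).fderiv_eq hV h z.2
        simp only [mkSmooth, this]
        rw [fderiv_const_mul (differentiableAt_smoothExt hV a z.2)]
        rfl }
    (fun a b => by
      ext z
      have h : Represents (fun w => smoothExt a w * smoothExt b w) (a * b) := fun w => by
        simp [represents_smoothExt a w, represents_smoothExt b w]
      have := (represents_smoothExt (a * b)).fderiv_eq hV h z.2
      simp only [mkSmooth, LinearMap.coe_mk, AddHom.coe_mk, this]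
      rw [fderiv_fun_mul (differentiableAt_smoothExt hV a z.2) (differentiableAt_smoothExt hV b z.2)]
      simp [represents_smoothExt a z, represents_smoothExt b z])

lemma Represents.fderiv {f : E → ℝ} {a : smoothFunctions V} (hf : Represents f a)
    (hV : IsOpen V) (u : E) : Represents (fun z => fderiv ℝ f z u) (directional hV u a) :=
  fun z => by
    have := hf.fderiv_eq hV (represents_smoothExt a) z.2
    simp only [this]
    rfl

lemma directional_comm (hV : IsOpen V) (u w : E) (a : smoothFunctions V) :
    directional hV u (directional hV w a) = directional hV w (directional hV u a) := by
  ext z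
  -- Both iterated derivatives are values of the second Fréchet derivative, so its symmetry gives
  -- the claim.
  have key : ∀ u w : E, (directional hV u (directional hV w a)).1 z =
      _root_.fderiv ℝ (_root_.fderiv ℝ (smoothExt a)) z u w := fun u w => by
    rw [← (((represents_smoothExt a).fderiv hV w).fderiv hV u) z]
    have hd : DifferentiableAt ℝ (_root_.fderiv ℝ (smoothExt a)) z :=
      (((contDiffOn_smoothExt a).fderiv_of_isOpen hV (m := ∞) (by simp)).contDiffAt
        (hV.mem_nhds z.2)).differentiableAt (by simp)
    change _root_.fderiv ℝ (fun z => _root_.fderiv ℝ (smoothExt a) z w) z u = _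
    rw [fderiv_clm_apply hd (differentiableAt_const w)]
    simp
  rw [key, key]
  have hs : IsSymmSndFDerivAt ℝ (smoothExt a) z :=
    ((contDiffOn_smoothExt a).contDiffAt (hV.mem_nhds z.2)).isSymmSndFDerivAt
      (by simpa using WithTop.coe_le_coe.2 (le_top : (2 : ℕ∞) ≤ ⊤))
  exact hs u w

end

end

end ConicFinsler

/-! ### Algebraic calculus of a metric that is quadratic in the direction -/

namespace ConicFinsler

/-- The calculus of a Riemannian surface metric in natural coordinates, over an algebra `A` of
functions of `(x, y)`: `W = F² / 2` is the energy, `e i` and `d i` are the derivations `∂̇ᵢ` and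
`∂ᵢ`, `s = 1 / √(ε det g)`, and `G` are the spray coefficients. -/
structure RiemannCalculus (A : Type*) [CommRing A] [Algebra ℝ A] where
  d : Fin 2 → Derivation ℝ A A
  e : Fin 2 → Derivation ℝ A A
  y : Fin 2 → A
  G : Fin 2 → A
  W : A
  F : A
  Finv : A
  s : A
  ε : A
  e_comm : ∀ i j a, e i (e j a) = e j (e i a)
  e_d : ∀ i j a, e i (d j a) = d j (e i a)
  e_y : ∀ i j, e i (y j) = if i = j then 1 else 0
  d_y : ∀ i j, d i (y j) = 0
  e_ε : ∀ i, e i ε = 0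
  ε_sq : ε ^ 2 = 1
  F_inv : F * Finv = 1
  F_sq : F ^ 2 = 2 * W
  euler_F : y 0 * e 0 F + y 1 * e 1 F = F
  cartan : ∀ i j k, e i (e j (e k W)) = 0
  s_sq : s ^ 2 * (ε * (e 0 (e 0 W) * e 1 (e 1 W) - e 0 (e 1 W) ^ 2)) = 1
  spray : ∀ h, 2 * (e h (e 0 W) * G 0 + e h (e 1 W) * G 1) =
    y 0 * d 0 (e h W) + y 1 * d 1 (e h W) - d h W

namespace RiemannCalculus

noncomputable section

variable {A : Type*} [CommRing A] [Algebra ℝ A]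

lemma two_cancel {a b : A} (h : 2 * a = 2 * b) : a = b := by
  have : (2 : A) = algebraMap ℝ A 2 := (map_ofNat _ 2).symm
  have h2 : algebraMap ℝ A (1 / 2) * 2 = 1 := by rw [this, ← map_mul]; norm_num
  linear_combination algebraMap ℝ A (1 / 2) * h - (a - b) * h2

lemma derivation_two_mul (δ : Derivation ℝ A A) (a : A) : δ (2 * a) = 2 * δ a := by
  rw [two_mul, map_add, two_mul]

lemma derivation_two (δ : Derivation ℝ A A) : δ 2 = 0 := by simpa using δ.map_natCast 2

variable (C : RiemannCalculus A)

/-- The vector field `v = ε F m`. -/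
def v (i : Fin 2) : A := (![-(C.s * C.e 1 C.W), C.s * C.e 0 C.W] : Fin 2 → A) i

lemma v_zero : C.v 0 = -(C.s * C.e 1 C.W) := rfl

lemma v_one : C.v 1 = C.s * C.e 0 C.W := rfl

/-- The derivation `f ↦ f_{;2}`. -/
def D : Derivation ℝ A A := C.v 0 • C.e 0 + C.v 1 • C.e 1

lemma D_apply (a : A) : C.D a = C.v 0 * C.e 0 a + C.v 1 * C.e 1 a := rfl

/-- The Liouville derivation `yⁱ ∂̇ᵢ`. -/
def Y : Derivation ℝ A A := C.y 0 • C.e 0 + C.y 1 • C.e 1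

lemma Y_apply (a : A) : C.Y a = C.y 0 * C.e 0 a + C.y 1 * C.e 1 a := rfl

/-- The horizontal derivation `δᵢ`. -/
def N (i : Fin 2) : Derivation ℝ A A :=
  C.d i - (C.e i (C.G 0) • C.e 0 + C.e i (C.G 1) • C.e 1)

lemma N_apply (i : Fin 2) (a : A) :
    C.N i a = C.d i a - (C.e i (C.G 0) * C.e 0 a + C.e i (C.G 1) * C.e 1 a) := rfl

/-- The h-scalar derivative `f_{,1}`. -/
def h1 (a : A) : A := C.Finv * (C.y 0 * C.N 0 a + C.y 1 * C.N 1 a)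

/-- The h-scalar derivative `f_{,2}`. -/
def h2 (a : A) : A := C.Finv * (C.v 0 * C.N 0 a + C.v 1 * C.N 1 a)

lemma Y_F : C.Y C.F = C.F := C.euler_F

lemma Y_W : C.Y C.W = 2 * C.W := by
  apply two_cancel
  have := congrArg C.Y C.F_sq
  simp only [pow_two, Y_F, derivation_two, Derivation.leibniz, smul_eq_mul] at this
  linear_combination -this + 2 * C.F_sq

lemma Y_e (i : Fin 2) (a : A) : C.Y (C.e i a) = C.e i (C.Y a) - C.e i a := by
  simp only [Y_apply, map_add, Derivation.leibniz, e_y, smul_eq_mul]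
  fin_cases i <;> simp [C.e_comm 1 0] <;> ring

lemma Y_d (i : Fin 2) (a : A) : C.Y (C.d i a) = C.d i (C.Y a) := by
  simp [Y_apply, e_d, d_y]

lemma Y_y (i : Fin 2) : C.Y (C.y i) = C.y i := by
  fin_cases i <;> simp [Y_apply, e_y]

lemma Y_eW (i : Fin 2) : C.Y (C.e i C.W) = C.e i C.W := by
  rw [Y_e, Y_W, derivation_two_mul]; ring

lemma eW_eq (i : Fin 2) : C.e i C.W = C.e 0 (C.e i C.W) * C.y 0 + C.e 1 (C.e i C.W) * C.y 1 := by
  have := C.Y_eW i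
  rw [Y_apply] at this
  linear_combination -this

/-- As g does not depend on y, differentiating s² ε det g = 1 leaves 2s (∂̇ᵢs) ε det g = 0, and
multiplying by s removes the determinant. -/
lemma e_s (i : Fin 2) : C.e i C.s = 0 := by
  have := congrArg (C.e i) C.s_sq
  simp [pow_two, C.cartan, C.e_ε] at this
  have h := C.s_sq
  apply two_cancel
  linear_combination C.s * this - 2 * C.e i C.s * h

lemma D_y (i : Fin 2) : C.D (C.y i) = C.v i := by
  fin_cases i <;> simp [D_apply, e_y]

lemma D_ε : C.D C.ε = 0 := by simp [D_apply, e_ε]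

lemma Y_ε : C.Y C.ε = 0 := by simp [Y_apply, e_ε]

/-- With R the rotation by a right angle, v = sRg y, and sRg does not depend on y. Hence Dv =
(sRg)²y, and since Rg is traceless, Cayley–Hamilton gives -s² det g · y = -εy. -/
lemma D_v (i : Fin 2) : C.D (C.v i) = -(C.ε * C.y i) := by
  have h := C.s_sq
  have h0 := C.eW_eq 0
  have h1 := C.eW_eq 1
  rw [C.e_comm 1 0] at h0
  have hε := C.ε_sq
  fin_cases i
  · simp only [D_apply, Fin.zero_eta, v_zero, v_one, map_neg, Derivation.leibniz, e_s, smul_eq_mul]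
    generalize C.e 0 (C.e 0 C.W) = g at *
    generalize C.e 0 (C.e 1 C.W) = g' at *
    generalize C.e 1 (C.e 1 C.W) = g'' at *
    rw [h0, h1]
    linear_combination -(C.ε * C.y 0) * h + C.y 0 * C.s ^ 2 *
      (g * g'' - g' ^ 2) * hε
  · simp only [D_apply, Fin.mk_one, v_zero, v_one, Derivation.leibniz, e_s, smul_eq_mul,
      C.e_comm 1 0]
    generalize C.e 0 (C.e 0 C.W) = g at *
    generalize C.e 0 (C.e 1 C.W) = g' at *
    generalize C.e 1 (C.e 1 C.W) = g'' at *
    rw [h0, h1]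
    linear_combination -(C.ε * C.y 1) * h + C.y 1 * C.s ^ 2 *
      (g * g'' - g' ^ 2) * hε

lemma F_cancel {a b : A} (h : C.F * a = C.F * b) : a = b := by
  linear_combination C.Finv * h - (a - b) * C.F_inv

lemma D_W : C.D C.W = 0 := by
  rw [D_apply, v_zero, v_one]; ring

lemma D_F : C.D C.F = 0 := by
  apply C.F_cancel
  apply two_cancel
  have := congrArg C.D C.F_sq
  rw [derivation_two_mul, D_W, pow_two, Derivation.leibniz, smul_eq_mul] at this
  linear_combination this

lemma Y_Finv : C.Y C.Finv = -C.Finv := by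
  have := congrArg C.Y C.F_inv
  simp [Y_F] at this
  exact C.F_cancel (by linear_combination this)

lemma Y_s : C.Y C.s = 0 := by simp [Y_apply, e_s]

lemma Y_v (i : Fin 2) : C.Y (C.v i) = C.v i := by
  fin_cases i <;> simp [v_zero, v_one, Y_s, Y_eW]

/-- D preserves the degree of homogeneity: v has degree one and a vertical derivative lowers the
degree by one. -/
lemma Y_D (a : A) : C.Y (C.D a) = C.D (C.Y a) := by
  rw [D_apply, D_apply, map_add, Derivation.leibniz, Derivation.leibniz]
  simp only [Y_e, Y_v, smul_eq_mul]
  ring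

/-- `y` and `v` are linearly independent. -/
lemma wedge : C.y 0 * C.v 1 - C.y 1 * C.v 0 = C.s * C.F ^ 2 := by
  have := C.Y_W
  rw [Y_apply] at this
  rw [C.F_sq, v_zero, v_one]
  linear_combination C.s * this

/-- This is g(m, m) = ε for v = εFm. As v is s times the rotated covector gy, g(v, v) is s² times
the adjugate of g at gy, that is s² det g · g(y, y). -/
lemma vv_metric : C.v 0 * C.v 0 * C.e 0 (C.e 0 C.W) + 2 * (C.v 0 * C.v 1 * C.e 0 (C.e 1 C.W))
    + C.v 1 * C.v 1 * C.e 1 (C.e 1 C.W) = C.ε * C.F ^ 2 := by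
  have h := C.s_sq
  have hY := C.Y_W
  rw [Y_apply] at hY
  have h0 := C.eW_eq 0
  have h1 := C.eW_eq 1
  rw [C.e_comm 1 0] at h0
  have hε := C.ε_sq
  have hF := C.F_sq
  generalize C.e 0 (C.e 0 C.W) = g at *
  generalize C.e 0 (C.e 1 C.W) = g' at *
  generalize C.e 1 (C.e 1 C.W) = g'' at *
  rw [hF, ← hY, v_zero, v_one, h0, h1]
  linear_combination (C.ε * (C.y 0 * (g * C.y 0 + g' * C.y 1)
    + C.y 1 * (g' * C.y 0 + g'' * C.y 1))) * h
    - (C.y 0 * (g * C.y 0 + g' * C.y 1)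
    + C.y 1 * (g' * C.y 0 + g'' * C.y 1)) * C.s ^ 2 *
      (g * g'' - g' ^ 2) * hε

/-- A linear system with the metric as its matrix has only the zero solution. -/
lemma metric_cancel {a b : A} (h0 : C.e 0 (C.e 0 C.W) * a + C.e 0 (C.e 1 C.W) * b = 0)
    (h1 : C.e 1 (C.e 0 C.W) * a + C.e 1 (C.e 1 C.W) * b = 0) : a = 0 ∧ b = 0 := by
  rw [C.e_comm 1 0] at h1
  have h := C.s_sq
  constructor
  · linear_combination -a * h + C.s ^ 2 * C.ε *
      (C.e 1 (C.e 1 C.W) * h0 - C.e 0 (C.e 1 C.W) * h1)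
  · linear_combination -b * h + C.s ^ 2 * C.ε *
      (C.e 0 (C.e 0 C.W) * h1 - C.e 0 (C.e 1 C.W) * h0)

/-- In the linear system for G the matrix has degree zero and the right-hand side degree two, so
Euler's operator can be moved past the invertible matrix. -/
lemma Y_G (i : Fin 2) : C.Y (C.G i) = 2 * C.G i := by
  have key : ∀ h, C.e h (C.e 0 C.W) * (C.Y (C.G 0) - 2 * C.G 0) +
      C.e h (C.e 1 C.W) * (C.Y (C.G 1) - 2 * C.G 1) = 0 := fun h => by
    have hs := congrArg C.Y (C.spray h)
    have hg : ∀ j k, C.Y (C.e j (C.e k C.W)) = 0 := fun j k => by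
      simp [Y_apply, cartan]
    simp only [map_add, map_sub, Derivation.leibniz, derivation_two,
      smul_eq_mul, hg, Y_d, Y_eW, Y_W,
      Y_y] at hs
    apply two_cancel
    linear_combination hs - 2 * C.spray h
  obtain ⟨h0, h1⟩ := C.metric_cancel (key 0) (key 1)
  fin_cases i
  · exact sub_eq_zero.1 h0
  · exact sub_eq_zero.1 h1

/-- A metric that does not depend on y is Berwaldian: the right-hand side of the system for G is
quadratic in y and the matrix is constant in y. -/
lemma eee_G (i j k r : Fin 2) : C.e r (C.e k (C.e j (C.G i))) = 0 := by
  have hd : ∀ i j k l, C.e i (C.e j (C.d l (C.e k C.W))) = 0 := fun i j k l => by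
    rw [e_d, e_d, cartan, map_zero]
  have hd' : ∀ i j k l, C.e i (C.e j (C.e k (C.d l C.W))) = 0 := fun i j k l => by
    rw [e_d, e_d, e_d, cartan, map_zero]
  have hey : ∀ i j k, C.e i (C.e j (C.y k)) = 0 := fun i j k => by
    rw [e_y]; split_ifs <;> simp
  have key : ∀ h, C.e h (C.e 0 C.W) * C.e r (C.e k (C.e j (C.G 0))) +
      C.e h (C.e 1 C.W) * C.e r (C.e k (C.e j (C.G 1))) = 0 := fun h => by
    have hs := congrArg (fun a => C.e r (C.e k (C.e j a))) (C.spray h)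
    simp only [derivation_two, map_add, map_sub, Derivation.leibniz, smul_eq_mul, hd, hd', hey,
      cartan, mul_zero, add_zero, zero_add, sub_zero] at hs
    apply two_cancel
    linear_combination hs
  obtain ⟨h0, h1⟩ := C.metric_cancel (key 0) (key 1)
  fin_cases i
  · exact h0
  · exact h1

lemma Y_N (i : Fin 2) (a : A) : C.Y (C.N i a) = C.N i (C.Y a) := by
  simp only [N_apply, map_sub, map_add, Derivation.leibniz, smul_eq_mul, Y_d, Y_e, Y_G,
    derivation_two]
  ring

lemma Y_h1 {a : A} (ha : C.Y a = 0) : C.Y (C.h1 a) = 0 := by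
  simp only [h1, map_add, Derivation.leibniz, smul_eq_mul, Y_N, ha, Y_y, Y_Finv, map_zero]
  ring

lemma Y_h2 {a : A} (ha : C.Y a = 0) : C.Y (C.h2 a) = 0 := by
  simp only [h2, map_add, Derivation.leibniz, smul_eq_mul, Y_N, ha, Y_v, Y_Finv, map_zero]
  ring

/-- For a function that is homogeneous of degree two, the third vertical derivative in the
direction `v`. -/
lemma vvv_eq {t : A} (ht : C.Y t = 2 * t) :
    ∑ i, ∑ j, ∑ k, C.v i * C.v j * C.v k * C.e i (C.e j (C.e k t)) =
      C.D (C.D (C.D t)) + 4 * (C.ε * C.D t) := by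
  have h0 := C.D_v 0
  have h1 := C.D_v 1
  have hyy : ∀ j, C.y 0 * C.e 0 (C.e j t) + C.y 1 * C.e 1 (C.e j t) = C.e j t := fun j => by
    rw [← Y_apply, Y_e, ht, derivation_two_mul]; ring
  -- When D hits a coefficient v it produces -εy, and Euler's identity turns the derivative along y
  -- into a multiple of the function itself.
  have e2 : C.D (C.D t) = C.v 0 * C.D (C.e 0 t) + C.v 1 * C.D (C.e 1 t) - 2 * (C.ε * t) := by
    rw [C.D_apply t, map_add, Derivation.leibniz, Derivation.leibniz, h0, h1]
    have := ht
    rw [Y_apply] at this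
    simp only [smul_eq_mul]
    linear_combination -C.ε * this
  have e3 : ∀ j, C.D (C.D (C.e j t)) = C.v 0 * C.D (C.e 0 (C.e j t)) + C.v 1 * C.D (C.e 1 (C.e j t))
      - C.ε * C.e j t := fun j => by
    rw [C.D_apply (C.e j t), map_add, Derivation.leibniz, Derivation.leibniz, h0, h1]
    simp only [smul_eq_mul]
    linear_combination -C.ε * hyy j
  rw [e2, map_sub, map_add, Derivation.leibniz, Derivation.leibniz, h0, h1, e3, e3, derivation_two_mul,
    Derivation.leibniz, D_ε]
  simp only [Fin.sum_univ_two, smul_eq_mul, D_apply]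
  have a0 := hyy 0
  have a1 := hyy 1
  simp only [C.e_comm 1 0] at *
  linear_combination C.ε * C.v 0 * a0 + C.ε * C.v 1 * a1

/-- The second vertical derivatives of a function of degree two have degree zero. -/
lemma y_eee {t : A} (ht : C.Y t = 2 * t) (j k : Fin 2) :
    C.y 0 * C.e 0 (C.e j (C.e k t)) + C.y 1 * C.e 1 (C.e j (C.e k t)) = 0 := by
  rw [← Y_apply, Y_e, Y_e, ht, derivation_two_mul]
  rw [map_sub, derivation_two_mul]; ring

end

end RiemannCalculus

end ConicFinsler

/-! ### The spray of the conformally changed metric and its third vertical derivative -/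

namespace ConicFinsler

namespace RiemannCalculus

noncomputable section

variable {A : Type*} [CommRing A] [Algebra ℝ A] (C : RiemannCalculus A)

/-- An anisotropic conformal factor `φ`, with `w = e^{2φ}` and the functions `ρ`, `P`, `Q` that
describe the change of the spray. -/
structure Factor where
  φ : A
  w : A
  winv : A
  ρ : A
  P : A
  Q : A
  Y_φ : C.Y φ = 0
  w_inv : w * winv = 1
  e_w : ∀ i, C.e i w = 2 * (w * C.e i φ)
  d_w : ∀ i, C.d i w = 2 * (w * C.d i φ)
  ρ_inv : ρ * (C.D (C.D φ) + C.D φ ^ 2 + C.ε) = 1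
  two_Q : 2 * Q = C.ε * ρ * C.F ^ 2 *
    (C.D φ * C.h1 φ + C.D (C.h1 φ) - 2 * C.h2 φ)
  two_P : 2 * P = -(ρ * C.F ^ 2 * C.D φ *
    (C.D φ * C.h1 φ + C.D (C.h1 φ) - 2 * C.h2 φ)) + C.F ^ 2 * C.h1 φ

namespace Factor

variable {C} (f : C.Factor)

/-- The energy of the changed metric. -/
def Wbar : A := f.w * C.W

/-- The change `Q mⁱ + P ℓⁱ` of the spray coefficients. -/
def T (i : Fin 2) : A := C.Finv * (C.ε * f.Q * C.v i + f.P * C.y i)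

lemma F_T (i : Fin 2) : C.F * f.T i = C.ε * f.Q * C.v i + f.P * C.y i := by
  rw [T]; linear_combination (C.ε * f.Q * C.v i + f.P * C.y i) * C.F_inv

lemma e_Wbar (i : Fin 2) : C.e i f.Wbar = f.w * (2 * (C.e i f.φ * C.W) + C.e i C.W) := by
  simp only [Wbar, Derivation.leibniz, smul_eq_mul, f.e_w]; ring

lemma d_Wbar (i : Fin 2) : C.d i f.Wbar = f.w * (2 * (C.d i f.φ * C.W) + C.d i C.W) := by
  simp only [Wbar, Derivation.leibniz, smul_eq_mul, f.d_w]; ring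

lemma e_e_Wbar (i j : Fin 2) : C.e i (C.e j f.Wbar) = f.w *
    ((4 * (C.e i f.φ * C.e j f.φ) + 2 * C.e i (C.e j f.φ)) * C.W + 2 * (C.e i f.φ * C.e j C.W)
      + 2 * (C.e j f.φ * C.e i C.W) + C.e i (C.e j C.W)) := by
  rw [e_Wbar]
  simp only [Derivation.leibniz, smul_eq_mul, f.e_w, map_add, derivation_two]; ring

lemma d_e_Wbar (i j : Fin 2) : C.d i (C.e j f.Wbar) = f.w *
    ((4 * (C.d i f.φ * C.e j f.φ) + 2 * C.d i (C.e j f.φ)) * C.W + 2 * (C.d i f.φ * C.e j C.W)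
      + 2 * (C.e j f.φ * C.d i C.W) + C.d i (C.e j C.W)) := by
  rw [e_Wbar]
  simp only [Derivation.leibniz, smul_eq_mul, f.d_w, map_add, derivation_two]; ring

end Factor

/-- Conservation of energy along the geodesic spray, S W = 0, obtained by contracting the spray
equation with y. -/
lemma spray_W : C.y 0 * C.d 0 C.W + C.y 1 * C.d 1 C.W =
    2 * (C.G 0 * C.e 0 C.W + C.G 1 * C.e 1 C.W) := by
  have h0 := C.spray 0
  have h1 := C.spray 1
  have hd : ∀ i, C.y 0 * C.d i (C.e 0 C.W) + C.y 1 * C.d i (C.e 1 C.W) = 2 * C.d i C.W :=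
    fun i => by
      have := C.Y_d i C.W
      rw [Y_W, derivation_two_mul, Y_apply, e_d, e_d] at this
      exact this
  have hd0 := hd 0
  have hd1 := hd 1
  have e0 := C.eW_eq 0
  have e1 := C.eW_eq 1
  rw [C.e_comm 1 0] at *
  linear_combination -C.y 0 * h0 - C.y 1 * h1 + 2 * C.G 0 * (-e0) + 2 * C.G 1 * (-e1)
    - C.y 0 * hd0 - C.y 1 * hd1

/-- The right-hand side is S a: Euler's identity for G turns yⁱ∂̇ᵢGʲ into 2Gʲ. -/
lemma F_h1 (a : A) : C.F * C.h1 a = C.y 0 * C.d 0 a + C.y 1 * C.d 1 a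
    - 2 * (C.G 0 * C.e 0 a + C.G 1 * C.e 1 a) := by
  have h0 := C.Y_G 0
  have h1 := C.Y_G 1
  rw [Y_apply] at h0 h1
  rw [RiemannCalculus.h1, ← mul_assoc, F_inv, one_mul, N_apply, N_apply]
  linear_combination -C.e 0 a * h0 - C.e 1 a * h1

lemma F_h2 (a : A) : C.F * C.h2 a = C.v 0 * C.N 0 a + C.v 1 * C.N 1 a := by
  rw [h2]; linear_combination (C.v 0 * C.N 0 a + C.v 1 * C.N 1 a) * C.F_inv

/-- The commutation of the vertical derivative along `v` with the spray. -/
lemma F_D_h1 (a : A) : C.F * (C.D (C.h1 a) - 2 * C.h2 a) =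
    C.v 0 * (C.y 0 * C.d 0 (C.e 0 a) + C.y 1 * C.d 1 (C.e 0 a) - C.d 0 a
      - 2 * (C.G 0 * C.e 0 (C.e 0 a) + C.G 1 * C.e 0 (C.e 1 a))) +
    C.v 1 * (C.y 0 * C.d 0 (C.e 1 a) + C.y 1 * C.d 1 (C.e 1 a) - C.d 1 a
      - 2 * (C.G 0 * C.e 1 (C.e 0 a) + C.G 1 * C.e 1 (C.e 1 a))) := by
  have h : C.D (C.F * C.h1 a) = C.F * C.D (C.h1 a) := by
    simp [Derivation.leibniz, D_F]
  have h2 := C.F_h2 a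
  rw [F_h1] at h
  simp only [D_apply (a := C.h1 a)] at *
  simp only [N_apply, D_apply, map_sub, map_add, Derivation.leibniz, smul_eq_mul, e_d,
    derivation_two, e_y, Fin.isValue, if_true, zero_ne_one, one_ne_zero, if_false] at *
  linear_combination -h - 2 * h2

/-- The terms in which D falls on v add up to -ε Y a, which vanishes in degree zero. -/
lemma D_D (a : A) (ha : C.Y a = 0) : C.D (C.D a) = C.v 0 * C.v 0 * C.e 0 (C.e 0 a)
    + 2 * (C.v 0 * C.v 1 * C.e 0 (C.e 1 a)) + C.v 1 * C.v 1 * C.e 1 (C.e 1 a) := by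
  have h0 := C.D_v 0
  have h1 := C.D_v 1
  rw [C.D_apply a, map_add, Derivation.leibniz, Derivation.leibniz, h0, h1, D_apply, D_apply,
    C.e_comm 1 0]
  rw [Y_apply] at ha
  simp only [smul_eq_mul]
  linear_combination -C.ε * ha

/-- A covector that vanishes on `y` and `v` is zero. -/
lemma frame_cancel (hs : ∃ t, C.s * t = 1) {a b : A} (hy : C.y 0 * a + C.y 1 * b = 0)
    (hv : C.v 0 * a + C.v 1 * b = 0) : a = 0 ∧ b = 0 := by
  obtain ⟨t, ht⟩ := hs
  have h := C.wedge
  have hF : C.s * C.F ^ 2 * (t * C.Finv ^ 2) = 1 := by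
    linear_combination C.F ^ 2 * C.Finv ^ 2 * ht + (C.F * C.Finv + 1) * C.F_inv
  constructor
  · linear_combination -a * hF - a * t * C.Finv ^ 2 * h
      + t * C.Finv ^ 2 * (C.v 1 * hy - C.y 1 * hv)
  · linear_combination -b * hF - b * t * C.Finv ^ 2 * h
      + t * C.Finv ^ 2 * (C.y 0 * hv - C.v 0 * hy)

lemma s_inv : ∃ t, C.s * t = 1 :=
  ⟨C.s * (C.ε * (C.e 0 (C.e 0 C.W) * C.e 1 (C.e 1 C.W) - C.e 0 (C.e 1 C.W) ^ 2)), by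
    linear_combination C.s_sq⟩

namespace Factor

variable {C} (f : C.Factor)

/-- This and `P_eq` are the formulas for Q and P cleared of ρ, the form in which the v- and
y-components of the new spray equation use them. -/
lemma D_eq : f.Q * (2 * (C.D (C.D f.φ) + C.D f.φ ^ 2 + C.ε)) = C.ε * C.F ^ 2 *
    (C.D f.φ * C.h1 f.φ + C.D (C.h1 f.φ) - 2 * C.h2 f.φ) := by
  linear_combination (C.D (C.D f.φ) + C.D f.φ ^ 2 + C.ε) * f.two_Q + C.ε * C.F ^ 2 *
    (C.D f.φ * C.h1 f.φ + C.D (C.h1 f.φ) - 2 * C.h2 f.φ) * f.ρ_inv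

lemma P_eq : 2 * f.P = C.F ^ 2 * C.h1 f.φ - 2 * C.ε * f.Q * C.D f.φ := by
  linear_combination f.two_P + C.ε * C.D f.φ * f.two_Q + f.ρ * C.F ^ 2 * C.D f.φ *
    (C.D f.φ * C.h1 f.φ + C.D (C.h1 f.φ) - 2 * C.h2 f.φ) * C.ε_sq

lemma Y_Wbar : C.Y f.Wbar = 2 * f.Wbar := by
  have := f.Y_φ
  have hW := C.Y_W
  rw [Y_apply] at *
  rw [e_Wbar, e_Wbar, Wbar]
  linear_combination 2 * f.w * C.W * this + f.w * hW

lemma Y_e_Wbar (i : Fin 2) :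
    C.y 0 * C.e i (C.e 0 f.Wbar) + C.y 1 * C.e i (C.e 1 f.Wbar) = C.e i f.Wbar := by
  rw [C.e_comm i 0, C.e_comm i 1, ← Y_apply, Y_e, Y_Wbar, derivation_two_mul]; ring

/-- The defining equation of the spray of the changed metric. -/
lemma spray_Wbar (h : Fin 2) :
    2 * (C.e h (C.e 0 f.Wbar) * (C.G 0 + f.T 0) + C.e h (C.e 1 f.Wbar) * (C.G 1 + f.T 1)) =
    C.y 0 * C.d 0 (C.e h f.Wbar) + C.y 1 * C.d 1 (C.e h f.Wbar) - C.d h f.Wbar := by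
  have hT0 := f.F_T 0
  have hT1 := f.F_T 1
  have hφ := f.Y_φ
  have hW := C.Y_W
  have hF1 := C.F_h1 f.φ
  have hSW := C.spray_W
  have hDW := C.D_W
  have hP := f.P_eq
  have hDφ := C.D_apply f.φ
  have hFF := C.F_sq
  rw [Y_apply] at hφ hW
  rw [D_apply] at hDW
  -- Contracted with y, the spray equation reduces by Euler's identity to conservation of the new
  -- energy; this determines P in terms of Q.
  have hy : C.y 0 * (2 * (C.e 0 (C.e 0 f.Wbar) * (C.G 0 + f.T 0)
        + C.e 0 (C.e 1 f.Wbar) * (C.G 1 + f.T 1)) -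
      (C.y 0 * C.d 0 (C.e 0 f.Wbar) + C.y 1 * C.d 1 (C.e 0 f.Wbar) - C.d 0 f.Wbar)) +
      C.y 1 * (2 * (C.e 1 (C.e 0 f.Wbar) * (C.G 0 + f.T 0)
        + C.e 1 (C.e 1 f.Wbar) * (C.G 1 + f.T 1)) -
      (C.y 0 * C.d 0 (C.e 1 f.Wbar) + C.y 1 * C.d 1 (C.e 1 f.Wbar) - C.d 1 f.Wbar)) = 0 := by
    have hd : ∀ i, C.y 0 * C.d i (C.e 0 f.Wbar) + C.y 1 * C.d i (C.e 1 f.Wbar)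
        = 2 * C.d i f.Wbar := fun i => by
      have := C.Y_d i f.Wbar
      rw [Y_Wbar, derivation_two_mul, Y_apply, e_d, e_d] at this
      exact this
    have hd0 := hd 0
    have hd1 := hd 1
    have he0 := f.Y_e_Wbar 0
    have he1 := f.Y_e_Wbar 1
    rw [C.e_comm 1 0]
    rw [C.e_comm 1 0] at he1
    suffices hmain : 2 * (C.e 0 f.Wbar * (C.G 0 + f.T 0) + C.e 1 f.Wbar * (C.G 1 + f.T 1)) =
        C.y 0 * C.d 0 f.Wbar + C.y 1 * C.d 1 f.Wbar by
      linear_combination hmain - C.y 0 * hd0 - C.y 1 * hd1 + 2 * (C.G 0 + f.T 0) * he0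
        + 2 * (C.G 1 + f.T 1) * he1
    apply C.F_cancel
    simp only [e_Wbar, d_Wbar]
    linear_combination f.w * (4 * C.W * C.e 0 f.φ + 2 * C.e 0 C.W) * hT0
      + f.w * (4 * C.W * C.e 1 f.φ + 2 * C.e 1 C.W) * hT1 + 4 * C.W * f.P * f.w * hφ
      + 2 * f.P * f.w * hW + 2 * C.ε * f.Q * f.w * hDW - f.w * C.F * hSW
      + 2 * C.W * C.F * f.w * hF1 + 2 * C.W * f.w * hP - 4 * C.W * C.ε * f.Q * f.w * hDφ
  -- The v-component contains the commutator of D with the spray (`F_D_h1`) and the Hessian of φ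
  -- along v; it determines Q.
  have hv : C.v 0 * (2 * (C.e 0 (C.e 0 f.Wbar) * (C.G 0 + f.T 0)
        + C.e 0 (C.e 1 f.Wbar) * (C.G 1 + f.T 1)) -
      (C.y 0 * C.d 0 (C.e 0 f.Wbar) + C.y 1 * C.d 1 (C.e 0 f.Wbar) - C.d 0 f.Wbar)) +
      C.v 1 * (2 * (C.e 1 (C.e 0 f.Wbar) * (C.G 0 + f.T 0)
        + C.e 1 (C.e 1 f.Wbar) * (C.G 1 + f.T 1)) -
      (C.y 0 * C.d 0 (C.e 1 f.Wbar) + C.y 1 * C.d 1 (C.e 1 f.Wbar) - C.d 1 f.Wbar)) = 0 := by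
    have hs0 := C.spray 0
    have hs1 := C.spray 1
    have hK := C.F_D_h1 f.φ
    have hDD := C.D_D f.φ f.Y_φ
    have hvv := C.vv_metric
    have hyφ : ∀ i, C.y 0 * C.e 0 (C.e i f.φ) + C.y 1 * C.e 1 (C.e i f.φ) = -C.e i f.φ :=
      fun i => by rw [← Y_apply, Y_e, f.Y_φ, map_zero, zero_sub]
    have hyφ0 := hyφ 0
    have hyφ1 := hyφ 1
    have hyW0 := C.Y_eW 0
    have hyW1 := C.Y_eW 1
    have hD := f.D_eq
    rw [Y_apply] at hyW0 hyW1
    rw [C.e_comm 1 0] at hs1 hyφ0 hyW0 hK ⊢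
    apply C.F_cancel
    simp only [e_e_Wbar, d_e_Wbar, d_Wbar]
    linear_combination f.w * (C.F * (4 * (C.G 0 * C.e 0 f.φ + C.G 1 * C.e 1 f.φ)
          - 2 * (C.y 0 * C.d 0 f.φ + C.y 1 * C.d 1 f.φ)
          + 4 * (f.T 0 * C.e 0 f.φ + f.T 1 * C.e 1 f.φ))
        + 4 * C.ε * f.Q * (C.v 0 * C.e 0 f.φ + C.v 1 * C.e 1 f.φ) + 2 * f.P) * hDW
      - 2 * (C.v 0 * C.e 0 f.φ + C.v 1 * C.e 1 f.φ) * C.F * f.w * hSW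
      + f.w * C.F * (C.v 0 * hs0 + C.v 1 * hs1)
      + 4 * C.W * C.F * (C.v 0 * C.e 0 f.φ + C.v 1 * C.e 1 f.φ) * f.w * hF1
      + 2 * C.W * C.F * f.w * hK
      + f.w * 2 * (C.v 0 * ((4 * C.e 0 f.φ * C.e 0 f.φ + 2 * C.e 0 (C.e 0 f.φ)) * C.W
          + 2 * C.e 0 f.φ * C.e 0 C.W + C.e 0 (C.e 0 C.W))
        + C.v 1 * ((4 * C.e 1 f.φ * C.e 0 f.φ + 2 * C.e 0 (C.e 1 f.φ)) * C.W
          + 2 * C.e 1 f.φ * C.e 0 C.W + C.e 0 (C.e 1 C.W))) * hT0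
      + f.w * 2 * (C.v 0 * ((4 * C.e 0 f.φ * C.e 1 f.φ + 2 * C.e 0 (C.e 1 f.φ)) * C.W
          + 2 * C.e 0 f.φ * C.e 1 C.W + C.e 0 (C.e 1 C.W))
        + C.v 1 * ((4 * C.e 1 f.φ * C.e 1 f.φ + 2 * C.e 1 (C.e 1 f.φ)) * C.W
          + 2 * C.e 1 f.φ * C.e 1 C.W + C.e 1 (C.e 1 C.W))) * hT1
      - 4 * C.ε * f.Q * C.W * f.w * hDD + 2 * C.ε * f.Q * f.w * hvv
      + 8 * f.P * C.W * (C.v 0 * C.e 0 f.φ + C.v 1 * C.e 1 f.φ) * f.w * hφ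
      + 4 * f.P * C.W * f.w * (C.v 0 * hyφ0 + C.v 1 * hyφ1)
      + 4 * f.P * (C.v 0 * C.e 0 f.φ + C.v 1 * C.e 1 f.φ) * f.w * hW
      + 2 * f.P * f.w * (C.v 0 * hyW0 + C.v 1 * hyW1)
      - f.w * (-4 * C.W * C.F ^ 2 * C.h1 f.φ + 8 * C.ε * f.Q * C.W *
          (C.v 0 * C.e 0 f.φ + C.v 1 * C.e 1 f.φ + C.D f.φ) + 4 * f.P * C.W) * hDφ
      + 2 * C.W * C.D f.φ * f.w * hP + 2 * C.ε ^ 2 * f.Q * f.w * hFF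
      + 2 * C.ε * C.W * f.w * hD + 2 * C.W * C.F ^ 2 * f.w *
        (C.D f.φ * C.h1 f.φ + C.D (C.h1 f.φ) - 2 * C.h2 f.φ) * C.ε_sq
  obtain ⟨h0, h1⟩ := C.frame_cancel C.s_inv hy hv
  fin_cases h
  · exact sub_eq_zero.1 h0
  · exact sub_eq_zero.1 h1

/-- The Gram determinant of the new metric in the frame y, v, with entries wF², wF²Dφ and wF²(D²φ +
2(Dφ)² + ε), equals its coordinate determinant times the square of `wedge`. The identity serves to
show that the new metric is non-degenerate. -/
lemma det_Wbar : (C.e 0 (C.e 0 f.Wbar) * C.e 1 (C.e 1 f.Wbar) - C.e 0 (C.e 1 f.Wbar) ^ 2) *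
    (C.s ^ 2 * f.ρ) = f.w ^ 2 := by
  have hvv : C.v 0 * C.v 0 * C.e 0 (C.e 0 f.Wbar) + 2 * (C.v 0 * C.v 1 * C.e 0 (C.e 1 f.Wbar))
      + C.v 1 * C.v 1 * C.e 1 (C.e 1 f.Wbar) =
      f.w * C.F ^ 2 * (C.D (C.D f.φ) + 2 * C.D f.φ ^ 2 + C.ε) := by
    have hDW := C.D_W
    have hDφ := C.D_apply f.φ
    have hDD := C.D_D f.φ f.Y_φ
    have hvv := C.vv_metric
    rw [D_apply] at hDW
    simp only [e_e_Wbar]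
    linear_combination f.w * hvv - 2 * f.w * C.W * hDD - f.w * 4 * C.W *
      (C.D f.φ + (C.v 0 * C.e 0 f.φ + C.v 1 * C.e 1 f.φ)) * hDφ
      + 4 * f.w * (C.v 0 * C.e 0 f.φ + C.v 1 * C.e 1 f.φ) * hDW
      - f.w * (C.D (C.D f.φ) + 2 * C.D f.φ ^ 2) * C.F_sq
  have hv : C.v 0 * C.e 0 f.Wbar + C.v 1 * C.e 1 f.Wbar = f.w * C.F ^ 2 * C.D f.φ := by
    have hDW := C.D_W
    have hDφ := C.D_apply f.φ
    rw [D_apply] at hDW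
    rw [e_Wbar, e_Wbar]
    linear_combination f.w * hDW - 2 * f.w * C.W * hDφ - f.w * C.D f.φ * C.F_sq
  have hy : C.y 0 * C.e 0 f.Wbar + C.y 1 * C.e 1 f.Wbar = f.w * C.F ^ 2 := by
    rw [← Y_apply, Y_Wbar, Wbar]; linear_combination -f.w * C.F_sq
  have h0 := f.Y_e_Wbar 0
  have h1 := f.Y_e_Wbar 1
  rw [C.e_comm 1 0] at h1
  have hw := C.wedge
  have key : C.F ^ 4 * ((C.e 0 (C.e 0 f.Wbar) * C.e 1 (C.e 1 f.Wbar)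
      - C.e 0 (C.e 1 f.Wbar) ^ 2) * C.s ^ 2) =
      C.F ^ 4 * (f.w ^ 2 * (C.D (C.D f.φ) + C.D f.φ ^ 2 + C.ε)) := by
    generalize C.e 0 (C.e 0 f.Wbar) = a at *
    generalize C.e 0 (C.e 1 f.Wbar) = b at *
    generalize C.e 1 (C.e 1 f.Wbar) = c at *
    rw [← h0, ← h1] at hv hy
    have hd : C.s ^ 2 * C.F ^ 4 = (C.y 0 * C.v 1 - C.y 1 * C.v 0) ^ 2 := by rw [hw]; ring
    have h1 : (a * c - b ^ 2) * (C.y 0 * C.v 1 - C.y 1 * C.v 0) ^ 2 =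
      (C.y 0 * (C.y 0 * a + C.y 1 * b) + C.y 1 * (C.y 0 * b + C.y 1 * c)) *
      (C.v 0 * C.v 0 * a + 2 * (C.v 0 * C.v 1 * b) + C.v 1 * C.v 1 * c) -
      (C.v 0 * (C.y 0 * a + C.y 1 * b) + C.v 1 * (C.y 0 * b + C.y 1 * c)) ^ 2 := by ring
    rw [hvv, hy, hv] at h1
    linear_combination (a * c - b ^ 2) * hd + h1
  have hF4 : C.F ^ 4 * C.Finv ^ 4 = 1 := by rw [← mul_pow, C.F_inv, one_pow]
  have key2 : (C.e 0 (C.e 0 f.Wbar) * C.e 1 (C.e 1 f.Wbar) - C.e 0 (C.e 1 f.Wbar) ^ 2) * C.s ^ 2 =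
      f.w ^ 2 * (C.D (C.D f.φ) + C.D f.φ ^ 2 + C.ε) := by
    linear_combination C.Finv ^ 4 * key - ((C.e 0 (C.e 0 f.Wbar) * C.e 1 (C.e 1 f.Wbar)
      - C.e 0 (C.e 1 f.Wbar) ^ 2) * C.s ^ 2 -
      f.w ^ 2 * (C.D (C.D f.φ) + C.D f.φ ^ 2 + C.ε)) * hF4
  linear_combination f.ρ * key2 + f.w ^ 2 * f.ρ_inv

lemma Y_ρ : C.Y f.ρ = 0 := by
  have h : C.Y (C.D (C.D f.φ) + C.D f.φ ^ 2 + C.ε) = 0 := by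
    simp [pow_two, Y_D, f.Y_φ, Y_ε]
  have := congrArg C.Y f.ρ_inv
  rw [Derivation.leibniz, h, smul_zero, zero_add, smul_eq_mul] at this
  rw [Derivation.map_one_eq_zero] at this
  linear_combination -C.Y f.ρ * f.ρ_inv + f.ρ * this

lemma Y_Q : C.Y f.Q = 2 * f.Q := by
  apply two_cancel
  have h1 := C.Y_h1 f.Y_φ
  have h2 := C.Y_h2 f.Y_φ
  have := congrArg C.Y f.two_Q
  simp only [pow_two, Derivation.leibniz, smul_eq_mul, derivation_two, map_add, map_sub, Y_D, h1,
    h2, f.Y_φ, Y_ε, Y_F, Y_ρ, map_zero] at this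
  linear_combination this - 2 * f.two_Q

lemma Y_P : C.Y f.P = 2 * f.P := by
  apply two_cancel
  have h1 := C.Y_h1 f.Y_φ
  have := congrArg C.Y f.P_eq
  simp only [pow_two, Derivation.leibniz, smul_eq_mul, derivation_two, map_sub, Y_D, h1,
    f.Y_φ, Y_ε, Y_F, Y_Q, map_zero] at this
  linear_combination this - 2 * f.P_eq

lemma Y_T (i : Fin 2) : C.Y (f.T i) = 2 * f.T i := by
  simp only [T, Derivation.leibniz, smul_eq_mul, map_add, Y_ε, Y_Q, Y_P, Y_v, Y_y, Y_Finv]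
  ring

/-- The `m`-component of the third vertical derivative of the change of the spray. -/
def mComponent : A :=
  3 * f.P + 3 * C.ε * C.D (C.D f.P) + C.ε * C.D f.Q + C.D (C.D (C.D f.Q))

/-- The `ℓ`-component of the third vertical derivative of the change of the spray. -/
def ellComponent : A :=
  -3 * C.ε * f.Q - 3 * C.D (C.D f.Q) + C.ε * C.D f.P + C.D (C.D (C.D f.P))

/-- On the pair (a, b) of coefficients of εav + by, D acts as D + J with J(a, b) = (εb, -a) and J² =
-ε. The two components are the rows of (D + J)³ + 4ε(D + J) = D³ + 3JD² + εD + 3εJ applied to (Q,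
P). -/
lemma F_vvv_T (i : Fin 2) :
    C.F * ∑ j, ∑ k, ∑ l, C.v j * C.v k * C.v l * C.e j (C.e k (C.e l (f.T i))) =
      C.ε * f.mComponent * C.v i + f.ellComponent * C.y i := by
  have hF : ∀ a, C.D (C.F * a) = C.F * C.D a := fun a => by simp [Derivation.leibniz, D_F]
  rw [C.vvv_eq (f.Y_T i)]
  have : C.F * (C.D (C.D (C.D (f.T i))) + 4 * (C.ε * C.D (f.T i))) =
      C.D (C.D (C.D (C.F * f.T i))) + 4 * (C.ε * C.D (C.F * f.T i)) := by
    simp only [hF]; ring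
  have key : ∀ a b, C.D (C.ε * a * C.v i + b * C.y i) =
      C.ε * (C.D a + C.ε * b) * C.v i + (C.D b - a) * C.y i := fun a b => by
    simp only [map_add, Derivation.leibniz, smul_eq_mul, D_ε, D_v, D_y]
    linear_combination -(b * C.v i + a * C.y i) * C.ε_sq
  rw [this, F_T, key, key, key, mComponent, ellComponent]
  simp only [map_add, map_sub, Derivation.leibniz, smul_eq_mul, D_ε, map_zero]
  linear_combination 3 * C.ε * f.P * C.v i * C.ε_sq

/-- The change of the spray vanishes along `m` if the sprays are projectively equivalent. -/
lemma wedge_T : C.F * (C.y 0 * f.T 1 - C.y 1 * f.T 0) = C.ε * f.Q * (C.s * C.F ^ 2) := by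
  rw [← C.wedge]
  linear_combination C.y 0 * f.F_T 1 - C.y 1 * f.F_T 0

/-- For Q = 0 one has 2P = F²φ_{,1}, and F is constant for D. -/
lemma two_mComponent (hQ : f.Q = 0) : 2 * f.mComponent =
    3 * C.F ^ 2 * (C.h1 f.φ + C.ε * C.D (C.D (C.h1 f.φ))) := by
  have hP := f.P_eq
  have hD : 2 * C.D (C.D f.P) = C.F ^ 2 * C.D (C.D (C.h1 f.φ)) := by
    have := congrArg (fun a => C.D (C.D a)) hP
    simpa [hQ, pow_two, Derivation.leibniz, D_F, derivation_two] using this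
  simp only [mComponent, hQ, map_zero]
  rw [hQ] at hP
  linear_combination 3 * hP + 3 * C.ε * hD

/-- Compared with `two_mComponent`, this component is ε/3 times D of the other one, so a single
condition on an open set is enough. -/
lemma two_ellComponent (hQ : f.Q = 0) : 2 * f.ellComponent =
    C.ε * C.F ^ 2 * C.D (C.h1 f.φ + C.ε * C.D (C.D (C.h1 f.φ))) := by
  have hP := f.P_eq
  have hD : 2 * C.D f.P = C.F ^ 2 * C.D (C.h1 f.φ) := by
    have := congrArg (fun a => C.D a) hP
    simpa [hQ, pow_two, Derivation.leibniz, D_F, derivation_two] using this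
  have hD3 : 2 * C.D (C.D (C.D f.P)) = C.F ^ 2 * C.D (C.D (C.D (C.h1 f.φ))) := by
    have := congrArg (fun a => C.D (C.D a)) hD
    simpa [pow_two, Derivation.leibniz, D_F, derivation_two] using this
  simp only [ellComponent, hQ, map_zero, map_add, Derivation.leibniz, smul_eq_mul, D_ε]
  linear_combination C.ε * hD + hD3 - C.F ^ 2 * C.D (C.D (C.D (C.h1 f.φ))) * C.ε_sq

end Factor

end

end RiemannCalculus

end ConicFinsler

/-! ### Realization of the calculus by smooth functions -/

namespace ConicFinsler

noncomputable section

section Elements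

variable {V : Set (Plane × Plane)} (hV : IsOpen V)

/-- `∂ᵢ` as a derivation. -/
def dxDer (i : Fin 2) : Derivation ℝ (smoothFunctions V) (smoothFunctions V) :=
  directional hV (EuclideanSpace.single i 1, 0)

/-- `∂̇ᵢ` as a derivation. -/
def dyDer (i : Fin 2) : Derivation ℝ (smoothFunctions V) (smoothFunctions V) :=
  directional hV (0, EuclideanSpace.single i 1)

variable {hV} {f : Plane × Plane → ℝ} {a : smoothFunctions V}

lemma Represents.dx (hf : Represents f a) (i : Fin 2) : Represents (dx i f) (dxDer hV i a) :=
  hf.fderiv hV _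

lemma Represents.dy (hf : Represents f a) (i : Fin 2) : Represents (dy i f) (dyDer hV i a) :=
  hf.fderiv hV _

/-- The coordinate function `yⁱ`. -/
def yFun (V : Set (Plane × Plane)) (i : Fin 2) : smoothFunctions V :=
  mkSmooth (fun z => z.2 i) (by fun_prop)

lemma hasFDerivAt_snd_apply (i : Fin 2) (z : Plane × Plane) :
    HasFDerivAt (fun z : Plane × Plane => z.2 i)
      ((EuclideanSpace.proj i : Plane →L[ℝ] ℝ).comp (ContinuousLinearMap.snd ℝ Plane Plane)) z :=
  ((EuclideanSpace.proj i : Plane →L[ℝ] ℝ).comp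
    (ContinuousLinearMap.snd ℝ Plane Plane)).hasFDerivAt

lemma dyDer_yFun (i j : Fin 2) : dyDer hV i (yFun V j) = if i = j then 1 else 0 := by
  have h : Represents (fun z : Plane × Plane => z.2 j) (yFun V j) := fun _ => rfl
  ext z
  rw [← h.dy i z, ConicFinsler.dy, (hasFDerivAt_snd_apply j z.1).fderiv]
  by_cases hij : i = j
  · subst hij; simp
  · simp [hij, Ne.symm hij]

lemma dxDer_yFun (i j : Fin 2) : dxDer hV i (yFun V j) = 0 := by
  have h : Represents (fun z : Plane × Plane => z.2 j) (yFun V j) := fun _ => rfl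
  ext z
  rw [← h.dx i z, ConicFinsler.dx, (hasFDerivAt_snd_apply j z.1).fderiv]
  simp

lemma eval_add (a b : smoothFunctions V) (z : V) : (a + b).1 z = a.1 z + b.1 z := rfl

lemma eval_sub (a b : smoothFunctions V) (z : V) : (a - b).1 z = a.1 z - b.1 z := rfl

lemma eval_mul (a b : smoothFunctions V) (z : V) : (a * b).1 z = a.1 z * b.1 z := rfl

lemma eval_pow (a : smoothFunctions V) (n : ℕ) (z : V) : (a ^ n).1 z = a.1 z ^ n := rfl

lemma eval_neg (a : smoothFunctions V) (z : V) : (-a).1 z = -a.1 z := rfl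

lemma eval_two (z : V) : (2 : smoothFunctions V).1 z = 2 := rfl

lemma eval_zero (z : V) : (0 : smoothFunctions V).1 z = 0 := rfl

lemma eval_algebraMap (r : ℝ) (z : V) : (algebraMap ℝ (smoothFunctions V) r).1 z = r := rfl

lemma eval_yFun (i : Fin 2) (z : V) : (yFun V i).1 z = z.1.2 i := rfl

lemma exists_inv (a : smoothFunctions V) (ha : ∀ z, a.1 z ≠ 0) :
    ∃ b : smoothFunctions V, ∀ z, b.1 z = (a.1 z)⁻¹ :=
  ⟨mkSmooth (fun z => (smoothExt a z)⁻¹) ((contDiffOn_smoothExt a).inv fun z hz => by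
    rw [represents_smoothExt a ⟨z, hz⟩]; exact ha _), fun z => by
      rw [← represents_smoothExt a z]; rfl⟩

lemma exists_sqrt (a : smoothFunctions V) (ha : ∀ z, 0 < a.1 z) :
    ∃ b : smoothFunctions V, ∀ z, b.1 z = Real.sqrt (a.1 z) :=
  ⟨mkSmooth (fun z => Real.sqrt (smoothExt a z)) ((contDiffOn_smoothExt a).sqrt fun z hz => by
    rw [represents_smoothExt a ⟨z, hz⟩]; exact (ha _).ne'), fun z => by
      rw [← represents_smoothExt a z]; rfl⟩

variable (hV) in
lemma exists_exp (a : smoothFunctions V) :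
    ∃ b : smoothFunctions V, (∀ z, b.1 z = Real.exp (a.1 z)) ∧
      ∀ u, directional hV u b = b * directional hV u a := by
  have hb : Represents (fun z => Real.exp (smoothExt a z))
    (mkSmooth (fun z => Real.exp (smoothExt a z)) (contDiffOn_smoothExt a).exp) := represents_mkSmooth _ _
  refine ⟨mkSmooth (fun z => Real.exp (smoothExt a z)) (contDiffOn_smoothExt a).exp, fun z => by
      rw [← represents_smoothExt a z]; rfl, fun u => ?_⟩
  ext z
  rw [← hb.fderiv hV u z]
  change _root_.fderiv ℝ (fun z => Real.exp (smoothExt a z)) z u = _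
  rw [_root_.fderiv_exp (differentiableAt_smoothExt hV a z.2)]
  rw [eval_mul, ← hb z, ← (represents_smoothExt a).fderiv hV u z]
  rfl

end Elements

/-! ### Metric tensor and spray coefficients in terms of the energy -/

section Spray

lemma metricMatrix_apply (F : Plane × Plane → ℝ) (z : Plane × Plane) (i j : Fin 2) :
    metricMatrix F z i j = metricTensor F i j z := rfl

/-- The spray coefficients are the solution of their defining linear system. -/
lemma sprayCoeff_eq_of {F : Plane × Plane → ℝ} {z : Plane × Plane} {X : Fin 2 → ℝ}
    (hdet : (metricMatrix F z).det ≠ 0)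
    (hX : ∀ h, metricTensor F h 0 z * X 0 + metricTensor F h 1 z * X 1 =
      1 / 4 * ((∑ r, z.2 r * dx r (dy h (fun w => F w ^ 2)) z) - dx h (fun w => F w ^ 2) z))
    (i : Fin 2) : sprayCoeff F i z = X i := by
  have h : (metricMatrix F z).mulVec X = fun h => 1 / 4 *
      ((∑ r, z.2 r * dx r (dy h (fun w => F w ^ 2)) z) - dx h (fun w => F w ^ 2) z) := by
    funext h
    rw [← hX, Matrix.mulVec, dotProduct, Fin.sum_univ_two]
    rfl
  have h2 : X = (metricMatrix F z)⁻¹.mulVec (fun h => 1 / 4 *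
      ((∑ r, z.2 r * dx r (dy h (fun w => F w ^ 2)) z) - dx h (fun w => F w ^ 2) z)) := by
    rw [← h, Matrix.mulVec_mulVec, Matrix.nonsing_inv_mul _ (isUnit_iff_ne_zero.2 hdet),
      Matrix.one_mulVec]
  rw [h2, sprayCoeff, Matrix.mulVec, dotProduct, Finset.mul_sum]
  exact Finset.sum_congr rfl fun j _ => by ring

variable {V : Set (Plane × Plane)} {hV : IsOpen V} {F : Plane × Plane → ℝ}
  {W : smoothFunctions V}

/-- The metric tensor is the vertical Hessian of the energy. -/
lemma represents_metricTensor (hW : Represents (fun w => F w ^ 2) (2 * W)) (i j : Fin 2) :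
    Represents (metricTensor F i j) (dyDer hV i (dyDer hV j W)) := fun z => by
  rw [metricTensor, ((hW.dy (hV := hV) j).dy (hV := hV) i) z,
    RiemannCalculus.derivation_two_mul, RiemannCalculus.derivation_two_mul]
  rw [eval_mul, eval_two]; ring

lemma represents_cartanTensor (hW : Represents (fun w => F w ^ 2) (2 * W)) (i j k : Fin 2) :
    ∀ z : V, cartanTensor F i j k z = 1 / 2 * (dyDer hV k (dyDer hV i (dyDer hV j W))).1 z :=
  fun z => by rw [cartanTensor, ((represents_metricTensor hW i j).dy k) z]

lemma det_metricMatrix (hW : Represents (fun w => F w ^ 2) (2 * W)) (z : V) :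
    (metricMatrix F z).det = (dyDer hV 0 (dyDer hV 0 W) * dyDer hV 1 (dyDer hV 1 W)
      - dyDer hV 0 (dyDer hV 1 W) ^ 2).1 z := by
  have hc : dyDer hV 1 (dyDer hV 0 W) = dyDer hV 0 (dyDer hV 1 W) := directional_comm hV _ _ _
  have h10 := represents_metricTensor (hV := hV) hW 1 0 z
  rw [hc] at h10
  rw [Matrix.det_fin_two]
  simp only [metricMatrix_apply, represents_metricTensor (hV := hV) hW 0 0 z,
    represents_metricTensor (hV := hV) hW 1 1 z, represents_metricTensor (hV := hV) hW 0 1 z, h10]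
  rw [eval_sub, eval_mul, eval_pow]; ring

/-- The spray coefficients in terms of the energy. -/
lemma represents_sprayCoeff (hW : Represents (fun w => F w ^ 2) (2 * W))
    (hdet : ∀ z ∈ V, (metricMatrix F z).det ≠ 0) {X : Fin 2 → smoothFunctions V}
    (hX : ∀ h, 2 * (dyDer hV h (dyDer hV 0 W) * X 0 + dyDer hV h (dyDer hV 1 W) * X 1) =
      yFun V 0 * dxDer hV 0 (dyDer hV h W) + yFun V 1 * dxDer hV 1 (dyDer hV h W)
        - dxDer hV h W) (i : Fin 2) :
    Represents (sprayCoeff F i) (X i) := fun z => by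
  refine sprayCoeff_eq_of (X := fun i => (X i).1 z) (hdet z z.2) (fun h => ?_) i
  have := congrFun (congrArg Subtype.val (hX h)) z
  rw [Fin.sum_univ_two, ((hW.dy (hV := hV) h).dx (hV := hV) 0) z,
    ((hW.dy (hV := hV) h).dx (hV := hV) 1) z, (hW.dx (hV := hV) h) z,
    represents_metricTensor (hV := hV) hW, represents_metricTensor (hV := hV) hW]
  simp only [RiemannCalculus.derivation_two_mul]
  simp only [eval_mul, eval_two, eval_add, eval_sub, eval_yFun] at this ⊢
  linear_combination 1 / 2 * this

end Spray

/-- A Riemannian metric function on an open set of coordinates, with signature `ε₀`. -/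
structure LocalMetric (F : Plane × Plane → ℝ) (V : Set (Plane × Plane)) (ε₀ : ℝ) : Prop where
  isOpen : IsOpen V
  smooth : ContDiffOn ℝ ∞ F V
  euler : ∀ z ∈ V, z.2 0 * dy 0 F z + z.2 1 * dy 1 F z = F z
  dir_ne_zero : ∀ z ∈ V, z.2 ≠ 0
  sign_sq : ε₀ ^ 2 = 1
  det_pos : ∀ z ∈ V, 0 < ε₀ * (metricMatrix F z).det
  cartan : ∀ z ∈ V, ∀ i j k, cartanTensor F i j k z = 0

namespace LocalMetric

variable {F : Plane × Plane → ℝ} {V : Set (Plane × Plane)} {ε₀ : ℝ} (h : LocalMetric F V ε₀)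

/-- The metric function. -/
def FE : smoothFunctions V := mkSmooth F h.smooth

/-- The energy. -/
def WE : smoothFunctions V := algebraMap ℝ _ (1 / 2) * h.FE ^ 2

lemma represents_F : Represents F h.FE := fun _ => rfl

lemma two_half : (2 : smoothFunctions V) * algebraMap ℝ _ (1 / 2) = 1 := by
  have : (2 : smoothFunctions V) = algebraMap ℝ _ 2 := (map_ofNat _ 2).symm
  rw [this, ← map_mul]; norm_num

lemma F_sq : h.FE ^ 2 = 2 * h.WE := by
  rw [WE, ← mul_assoc, two_half, one_mul]

lemma represents_sq : Represents (fun w => F w ^ 2) (2 * h.WE) := by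
  rw [← F_sq]; exact fun _ => rfl

lemma e_W (i : Fin 2) : dyDer h.isOpen i h.WE = h.FE * dyDer h.isOpen i h.FE := by
  apply RiemannCalculus.two_cancel
  rw [← RiemannCalculus.derivation_two_mul, ← F_sq, pow_two, Derivation.leibniz, smul_eq_mul]
  ring

lemma euler_F : yFun V 0 * dyDer h.isOpen 0 h.FE + yFun V 1 * dyDer h.isOpen 1 h.FE = h.FE := by
  ext z
  have := h.euler z z.2
  rw [h.represents_F.dy (hV := h.isOpen) 0 z, h.represents_F.dy (hV := h.isOpen) 1 z] at this
  exact this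

lemma cartan_E (i j k : Fin 2) :
    dyDer h.isOpen i (dyDer h.isOpen j (dyDer h.isOpen k h.WE)) = 0 := by
  ext z
  have := h.cartan z z.2 j k i
  rw [represents_cartanTensor (hV := h.isOpen) h.represents_sq] at this
  change _ = 0
  linarith

/-- `det g`. -/
def detE : smoothFunctions V :=
  dyDer h.isOpen 0 (dyDer h.isOpen 0 h.WE) * dyDer h.isOpen 1 (dyDer h.isOpen 1 h.WE)
    - dyDer h.isOpen 0 (dyDer h.isOpen 1 h.WE) ^ 2

lemma det_eq (z : V) : (metricMatrix F z).det = h.detE.1 z :=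
  det_metricMatrix h.represents_sq z

/-- At a zero of F the covector ∂̇W = F ∂̇F vanishes. By Euler's identity it equals gy, so
non-degeneracy of g would force y = 0. -/
lemma F_ne_zero (h : LocalMetric F V ε₀) (z : V) : F z ≠ 0 := by
  intro h0
  have hW : ∀ i, (dyDer h.isOpen i h.WE).1 z = 0 := fun i => by
    rw [e_W]; change F z * _ = 0; rw [h0, zero_mul]
  have hE : yFun V 0 * dyDer h.isOpen 0 h.WE + yFun V 1 * dyDer h.isOpen 1 h.WE = 2 * h.WE := by
    rw [e_W, e_W, ← F_sq]; linear_combination h.FE * h.euler_F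
  have he : ∀ i, yFun V 0 * dyDer h.isOpen i (dyDer h.isOpen 0 h.WE) +
      yFun V 1 * dyDer h.isOpen i (dyDer h.isOpen 1 h.WE) = dyDer h.isOpen i h.WE := fun i => by
    have := congrArg (dyDer h.isOpen i) hE
    rw [RiemannCalculus.derivation_two_mul] at this
    simp only [map_add, Derivation.leibniz, smul_eq_mul, dyDer_yFun] at this
    fin_cases i <;> simp at this ⊢ <;> linear_combination this
  have h0' := congrFun (congrArg Subtype.val (he 0)) z
  have h1' := congrFun (congrArg Subtype.val (he 1)) z
  rw [hW] at h0' h1'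
  have hc : dyDer h.isOpen 1 (dyDer h.isOpen 0 h.WE) = dyDer h.isOpen 0 (dyDer h.isOpen 1 h.WE) :=
    directional_comm _ _ _ _
  rw [hc] at h1'
  simp only [eval_mul, eval_add, eval_yFun] at h0' h1'
  have hd := h.det_pos z z.2
  rw [h.det_eq] at hd
  have hd' : h.detE.1 z ≠ 0 := fun h0 => by rw [h0, mul_zero] at hd; exact hd.false
  rw [show h.detE.1 z = (dyDer h.isOpen 0 (dyDer h.isOpen 0 h.WE)).1 z *
    (dyDer h.isOpen 1 (dyDer h.isOpen 1 h.WE)).1 z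
    - (dyDer h.isOpen 0 (dyDer h.isOpen 1 h.WE)).1 z ^ 2 from rfl] at hd'
  apply h.dir_ne_zero z z.2
  ext i
  revert i
  rw [Fin.forall_fin_two]
  constructor
  · refine (mul_eq_zero.1 ?_).resolve_right hd'
    linear_combination (dyDer h.isOpen 1 (dyDer h.isOpen 1 h.WE)).1 z * h0'
      - (dyDer h.isOpen 0 (dyDer h.isOpen 1 h.WE)).1 z * h1'
  · refine (mul_eq_zero.1 ?_).resolve_right hd'
    linear_combination (dyDer h.isOpen 0 (dyDer h.isOpen 0 h.WE)).1 z * h1'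
      - (dyDer h.isOpen 0 (dyDer h.isOpen 1 h.WE)).1 z * h0'

/-- `1 / F`. -/
def FinvE : smoothFunctions V := Classical.choose (exists_inv h.FE h.F_ne_zero)

lemma FinvE_apply (z : V) : h.FinvE.1 z = (F z)⁻¹ :=
  Classical.choose_spec (exists_inv h.FE h.F_ne_zero) z

lemma exists_s (h : LocalMetric F V ε₀) : ∃ s : smoothFunctions V,
    ∀ z : V, s.1 z = (Real.sqrt (ε₀ * (metricMatrix F z).det))⁻¹ := by
  have hp : ∀ z : V, 0 < (algebraMap ℝ (smoothFunctions V) ε₀ * h.detE).1 z := fun z => by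
    have := h.det_pos z z.2
    rwa [det_eq] at this
  obtain ⟨r, hr⟩ := exists_sqrt _ hp
  obtain ⟨s, hs⟩ := exists_inv r fun z => by rw [hr]; exact (Real.sqrt_pos.2 (hp z)).ne'
  exact ⟨s, fun z => by rw [hs, hr, det_eq]; rfl⟩

/-- `1 / √(ε det g)`. -/
def sE : smoothFunctions V := Classical.choose h.exists_s

lemma sE_apply (z : V) : h.sE.1 z = (Real.sqrt (ε₀ * (metricMatrix F z).det))⁻¹ :=
  Classical.choose_spec h.exists_s z

lemma s_sq : h.sE ^ 2 * (algebraMap ℝ _ ε₀ * h.detE) = 1 := by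
  ext z
  change h.sE.1 z ^ 2 * (ε₀ * h.detE.1 z) = 1
  have hp := h.det_pos z z.2
  rw [sE_apply, ← det_eq, inv_pow, Real.sq_sqrt hp.le, inv_mul_cancel₀ hp.ne']

/-- The right hand side of the equation of the spray coefficients. -/
def sprayRhs (i : Fin 2) : smoothFunctions V :=
  yFun V 0 * dxDer h.isOpen 0 (dyDer h.isOpen i h.WE) +
    yFun V 1 * dxDer h.isOpen 1 (dyDer h.isOpen i h.WE) - dxDer h.isOpen i h.WE

/-- The spray coefficients. -/
def GE : Fin 2 → smoothFunctions V :=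
  ![algebraMap ℝ _ (1 / 2) * (h.sE ^ 2 * algebraMap ℝ _ ε₀ *
      (dyDer h.isOpen 1 (dyDer h.isOpen 1 h.WE) * h.sprayRhs 0
        - dyDer h.isOpen 0 (dyDer h.isOpen 1 h.WE) * h.sprayRhs 1)),
    algebraMap ℝ _ (1 / 2) * (h.sE ^ 2 * algebraMap ℝ _ ε₀ *
      (dyDer h.isOpen 0 (dyDer h.isOpen 0 h.WE) * h.sprayRhs 1
        - dyDer h.isOpen 0 (dyDer h.isOpen 1 h.WE) * h.sprayRhs 0))]

/-- Cramer's rule, with s²ε the inverse of det g. -/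
lemma spray_E (i : Fin 2) : 2 * (dyDer h.isOpen i (dyDer h.isOpen 0 h.WE) * h.GE 0 +
    dyDer h.isOpen i (dyDer h.isOpen 1 h.WE) * h.GE 1) = h.sprayRhs i := by
  have hs := h.s_sq
  have h2 := two_half (V := V)
  have hc : dyDer h.isOpen 1 (dyDer h.isOpen 0 h.WE) = dyDer h.isOpen 0 (dyDer h.isOpen 1 h.WE) :=
    directional_comm _ _ _ _
  rw [detE] at hs
  simp only [GE, Matrix.cons_val_zero, Matrix.cons_val_one]
  generalize algebraMap ℝ (smoothFunctions V) (1 / 2) = c at *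
  fin_cases i
  · simp only [Fin.zero_eta]
    linear_combination h.sprayRhs 0 * 2 * c * hs + h.sprayRhs 0 * h2
  · simp only [Fin.mk_one, hc]
    linear_combination h.sprayRhs 1 * 2 * c * hs + h.sprayRhs 1 * h2

/-- The calculus of the metric over the smooth functions. -/
def calculus : RiemannCalculus (smoothFunctions V) where
  d := dxDer h.isOpen
  e := dyDer h.isOpen
  y := yFun V
  G := h.GE
  W := h.WE
  F := h.FE
  Finv := h.FinvE
  s := h.sE
  ε := algebraMap ℝ _ ε₀
  e_comm _ _ _ := directional_comm _ _ _ _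
  e_d _ _ _ := directional_comm _ _ _ _
  e_y := dyDer_yFun
  d_y := dxDer_yFun
  e_ε _ := Derivation.map_algebraMap _ _
  ε_sq := by rw [← map_pow, h.sign_sq, map_one]
  F_inv := by
    ext z
    change F z * h.FinvE.1 z = 1
    rw [FinvE_apply, mul_inv_cancel₀ (h.F_ne_zero z)]
  F_sq := h.F_sq
  euler_F := h.euler_F
  cartan := h.cartan_E
  s_sq := h.s_sq
  spray := h.spray_E

end LocalMetric

end

end ConicFinsler

/-! ### Dictionary between the pointwise definitions and the calculus -/

namespace ConicFinsler

noncomputable section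

namespace LocalMetric

open RiemannCalculus

variable {F : Plane × Plane → ℝ} {V : Set (Plane × Plane)} {ε₀ : ℝ} (h : LocalMetric F V ε₀)
  {f : Plane × Plane → ℝ} {a : smoothFunctions V}

lemma eval_F (z : V) : h.calculus.F.1 z = F z := rfl

lemma eval_ε (z : V) : h.calculus.ε.1 z = ε₀ := rfl

lemma eps_eq (h : LocalMetric F V ε₀) (z : V) : eps F z = ε₀ := by
  have hp := h.det_pos z z.2
  rw [eps]
  rcases sq_eq_sq_iff_eq_or_eq_neg.1 (h.sign_sq.trans (one_pow 2).symm) with h1 | h1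
  · rw [h1, one_mul] at hp; rw [h1, Real.sign_of_pos hp]
  · rw [h1] at hp; rw [h1, Real.sign_of_neg (by linarith)]

/-- Since ∂̇ᵢW = Fℓᵢ, the field v of the calculus is εFm. -/
lemma F_mul_mUp (i : Fin 2) (z : V) : ε₀ * F z * mUp F i z = (h.calculus.v i).1 z := by
  have hs := h.sE_apply z
  have he : ∀ i, (dyDer h.isOpen i h.WE).1 z = F z * dy i F z := fun i => by
    rw [e_W, eval_mul, h.represents_F.dy (hV := h.isOpen) i z]; rfl
  have hv : (h.calculus.v i).1 z =
      (![-(h.sE.1 z * (dyDer h.isOpen 1 h.WE).1 z), h.sE.1 z * (dyDer h.isOpen 0 h.WE).1 z] :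
        Fin 2 → ℝ) i := by
    fin_cases i <;> rfl
  rw [hv, mUp, h.eps_eq z, hs, he, he]
  have := h.sign_sq
  revert i
  rw [Fin.forall_fin_two]
  constructor
  · intro _
    simp only [Matrix.cons_val_zero, ellLow]
    linear_combination (-F z * (Real.sqrt (ε₀ * (metricMatrix F z).det))⁻¹ * dy 1 F z) * this
  · intro _
    simp only [Matrix.cons_val_one, Matrix.cons_val_zero, ellLow]
    linear_combination (F z * (Real.sqrt (ε₀ * (metricMatrix F z).det))⁻¹ * dy 0 F z) * this

lemma mUp_eq (i : Fin 2) (z : V) : mUp F i z = ε₀ * (F z)⁻¹ * (h.calculus.v i).1 z := by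
  rw [← F_mul_mUp]
  have := mul_inv_cancel₀ (h.F_ne_zero z)
  linear_combination -mUp F i z * ε₀ ^ 2 * this - mUp F i z * h.sign_sq

lemma represents_vDeriv2 (hf : Represents f a) : Represents (vDeriv2 F f) (h.calculus.D a) :=
  fun z => by
    rw [vDeriv2, D_apply, eval_add, eval_mul, eval_mul, ← F_mul_mUp, ← F_mul_mUp, h.eps_eq z,
      Fin.sum_univ_two, hf.dy (hV := h.isOpen) 0 z, hf.dy (hV := h.isOpen) 1 z]
    change _ = _ * (dyDer h.isOpen 0 a).1 z + _ * (dyDer h.isOpen 1 a).1 z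
    ring

lemma represents_spray (i : Fin 2) : Represents (sprayCoeff F i) (h.calculus.G i) :=
  represents_sprayCoeff (hV := h.isOpen) h.represents_sq
    (fun z hz h0 => by have := h.det_pos z hz; rw [h0, mul_zero] at this; exact this.false)
    h.spray_E i

lemma represents_barthel (i j : Fin 2) :
    Represents (barthel F i j) (h.calculus.e j (h.calculus.G i)) :=
  (h.represents_spray i).dy (hV := h.isOpen) j

lemma represents_delta (hf : Represents f a) (i : Fin 2) :
    Represents (delta F i f) (h.calculus.N i a) := fun z => by
  rw [delta, Fin.sum_univ_two, N_apply, eval_sub, eval_add, eval_mul, eval_mul,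
    h.represents_barthel 0 i z, h.represents_barthel 1 i z, hf.dy (hV := h.isOpen) 0 z,
    hf.dy (hV := h.isOpen) 1 z, hf.dx (hV := h.isOpen) i z]
  rfl

lemma represents_hDeriv1 (hf : Represents f a) :
    Represents (hDeriv1 F f) (h.calculus.h1 a) := fun z => by
  rw [hDeriv1, Fin.sum_univ_two, h.represents_delta hf 0 z, h.represents_delta hf 1 z, ellUp,
    ellUp, RiemannCalculus.h1, eval_mul, eval_add, eval_mul, eval_mul]
  change _ = h.FinvE.1 z * (z.1.2 0 * _ + z.1.2 1 * _)
  rw [FinvE_apply]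
  ring

lemma represents_hDeriv2 (hf : Represents f a) :
    Represents (hDeriv2 F f) (h.calculus.h2 a) := fun z => by
  rw [hDeriv2, Fin.sum_univ_two, h.represents_delta hf 0 z, h.represents_delta hf 1 z, h.mUp_eq,
    h.mUp_eq, RiemannCalculus.h2, eval_mul, eval_add, eval_mul, eval_mul, h.eps_eq z]
  change _ = h.FinvE.1 z * _
  rw [FinvE_apply]
  linear_combination (F z)⁻¹ * ((h.calculus.N 0 a).1 z * (h.calculus.v 0).1 z +
    (h.calculus.N 1 a).1 z * (h.calculus.v 1).1 z) * h.sign_sq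

lemma mainScalar_eq_zero (h : LocalMetric F V ε₀) (z : V) : mainScalar F z = 0 := by
  simp [mainScalar, h.cartan z z.2]

/-- As m = εv/F, the factor F² is absorbed in passing from m to v, and `D_D` applies. The
non-vanishing assumption thus says that ρ exists. -/
lemma changeFactor_eq (hf : Represents f a) (ha : h.calculus.Y a = 0) (z : V) :
    changeFactor F f z = (h.calculus.D (h.calculus.D a) + h.calculus.D a ^ 2 + h.calculus.ε).1 z := by
  have hd := hf.dy (hV := h.isOpen)
  have hdd := fun i j => (hd i).dy (hV := h.isOpen) j
  rw [h.calculus.D_D a ha, D_apply, changeFactor]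
  simp only [Fin.sum_univ_two, hd _ z, hdd _ _ z, h.mUp_eq, h.eps_eq z, eval_add, eval_mul,
    eval_pow, eval_two]
  have hF := h.F_ne_zero z
  have hs := h.sign_sq
  have hc : h.calculus.e 1 (h.calculus.e 0 a) = h.calculus.e 0 (h.calculus.e 1 a) :=
    h.calculus.e_comm _ _ _
  change F z ^ 2 * (((h.calculus.e 0 (h.calculus.e 0 a)).1 z +
    (h.calculus.e 0 a).1 z * (h.calculus.e 0 a).1 z) * _ * _ +
    ((h.calculus.e 0 (h.calculus.e 1 a)).1 z +
    (h.calculus.e 0 a).1 z * (h.calculus.e 1 a).1 z) * _ * _ +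
    (((h.calculus.e 1 (h.calculus.e 0 a)).1 z +
    (h.calculus.e 1 a).1 z * (h.calculus.e 0 a).1 z) * _ * _ +
    ((h.calculus.e 1 (h.calculus.e 1 a)).1 z +
    (h.calculus.e 1 a).1 z * (h.calculus.e 1 a).1 z) * _ * _)) + ε₀ = _ + ε₀
  rw [hc]
  have h2 : F z ^ 2 * (ε₀ * (F z)⁻¹) ^ 2 = 1 := by
    field_simp
    exact hs
  linear_combination (((h.calculus.e 0 (h.calculus.e 0 a)).1 z +
    (h.calculus.e 0 a).1 z * (h.calculus.e 0 a).1 z) * (h.calculus.v 0).1 z ^ 2 +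
    2 * ((h.calculus.e 0 (h.calculus.e 1 a)).1 z +
    (h.calculus.e 0 a).1 z * (h.calculus.e 1 a).1 z) * (h.calculus.v 0).1 z * (h.calculus.v 1).1 z
    + ((h.calculus.e 1 (h.calculus.e 1 a)).1 z +
    (h.calculus.e 1 a).1 z * (h.calculus.e 1 a).1 z) * (h.calculus.v 1).1 z ^ 2) * h2

/-- The conformal factor as an element of the calculus of the metric, with the functions that are
attached to it. -/
lemma exists_factor {φ : Plane × Plane → ℝ} (hφ : ContDiffOn ℝ ∞ φ V)
    (heuler : ∀ z ∈ V, z.2 0 * dy 0 φ z + z.2 1 * dy 1 φ z = 0)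
    (hne : ∀ z ∈ V, changeFactor F φ z ≠ 0) :
    ∃ f : h.calculus.Factor, Represents φ f.φ ∧ Represents (Q F φ) f.Q ∧
      Represents (P F φ) f.P ∧
      Represents (fun z => (Real.exp (φ z) * F z) ^ 2) (2 * f.Wbar) := by
  obtain ⟨a, hr⟩ : ∃ a : smoothFunctions V, Represents φ a :=
    ⟨mkSmooth φ hφ, represents_mkSmooth φ hφ⟩
  have hY : h.calculus.Y a = 0 := by
    ext z
    have := heuler z z.2
    rw [hr.dy (hV := h.isOpen) 0 z, hr.dy (hV := h.isOpen) 1 z] at this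
    exact this
  -- The energy is quadratic in F, so it is multiplied by e^{2φ}.
  obtain ⟨w, hw, hdw⟩ := exists_exp h.isOpen (2 * a)
  obtain ⟨winv, hwinv⟩ := exists_inv w fun z => by rw [hw]; exact (Real.exp_pos _).ne'
  obtain ⟨ρ, hρ⟩ := exists_inv
    (h.calculus.D (h.calculus.D a) + h.calculus.D a ^ 2 + h.calculus.ε) fun z => by
      rw [← h.changeFactor_eq hr hY]; exact hne z z.2
  have hρ1 : ρ * (h.calculus.D (h.calculus.D a) + h.calculus.D a ^ 2 + h.calculus.ε) = 1 := by
    ext z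
    rw [eval_mul, hρ]
    exact inv_mul_cancel₀ (by rw [← h.changeFactor_eq hr hY]; exact hne z z.2)
  have hD := h.represents_vDeriv2 hr
  have hDD := h.represents_vDeriv2 hD
  have h1 := h.represents_hDeriv1 hr
  have h2 := h.represents_hDeriv2 hr
  have hD1 := h.represents_vDeriv2 h1
  -- The main scalar vanishes, so the denominator σ + ε - (φ_{;2})² is D²φ + (Dφ)² + ε.
  have hρr : Represents (rho F φ) ρ := fun z => by
    rw [rho, hρ, sigma, h.mainScalar_eq_zero z, hD z, hDD z, h.eps_eq z, one_div]
    congr 1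
    rw [eval_add, eval_add, eval_pow]
    change _ = _ + _ + ε₀
    ring
  have hQ : Represents (Q F φ) (algebraMap ℝ _ (1 / 2) * (h.calculus.ε * ρ * h.calculus.F ^ 2 *
      (h.calculus.D a * h.calculus.h1 a + h.calculus.D (h.calculus.h1 a)
        - 2 * h.calculus.h2 a))) := fun z => by
    simp only [Q, hρr z, hD z, h1 z, hD1 z, h2 z, h.eps_eq z, eval_mul, eval_add, eval_sub,
      eval_pow, eval_two, eval_algebraMap, eval_F, eval_ε]
  have hP : Represents (P F φ) (algebraMap ℝ _ (1 / 2) * (-(ρ * h.calculus.F ^ 2 * h.calculus.D a *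
      (h.calculus.D a * h.calculus.h1 a + h.calculus.D (h.calculus.h1 a) - 2 * h.calculus.h2 a))
      + h.calculus.F ^ 2 * h.calculus.h1 a)) := fun z => by
    simp only [P, hρr z, hD z, h1 z, hD1 z, h2 z, eval_mul, eval_add, eval_sub, eval_neg,
      eval_pow, eval_two, eval_algebraMap, eval_F]
  have hW : Represents (fun z => (Real.exp (φ z) * F z) ^ 2) (2 * (w * h.WE)) := fun z => by
    have hF := congrFun (congrArg Subtype.val h.F_sq) z
    rw [eval_pow, eval_mul, ← h.represents_F z] at hF
    simp only [eval_mul, eval_two] at hF ⊢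
    rw [mul_pow, hF, hw, eval_mul, hr z, eval_two, ← Real.exp_nat_mul]
    push_cast
    ring
  have hwi : w * winv = 1 := by
    ext z
    rw [eval_mul, hwinv]
    exact mul_inv_cancel₀ (by rw [hw]; exact (Real.exp_pos _).ne')
  have hdw' : ∀ u, directional h.isOpen u w = 2 * (w * directional h.isOpen u a) := fun u => by
    rw [hdw, derivation_two_mul, mul_left_comm]
  exact ⟨⟨a, w, winv, ρ, _, _, hY, hwi, fun i => hdw' _, fun i => hdw' _, hρ1,
    by rw [← mul_assoc, two_half, one_mul], by rw [← mul_assoc, two_half, one_mul]⟩,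
    hr, hQ, hP, hW⟩

end LocalMetric

end

end ConicFinsler

/-! ### Natural coordinates on the tangent bundle -/

namespace ConicFinsler

noncomputable section

section Charts

variable {M : Type*} [TopologicalSpace M] [ChartedSpace Plane M]

lemma tangentPoint_smul (e : OpenPartialHomeomorph M Plane) (x y : Plane) (c : ℝ) :
    tangentPoint e (x, c • y) = ⟨(tangentPoint e (x, y)).1, c • (tangentPoint e (x, y)).2⟩ := by
  simp only [tangentPoint]
  congr 1
  exact map_smul (mfderiv 𝓘(ℝ, Plane) 𝓘(ℝ, Plane) e.symm x) c y

variable [IsManifold 𝓘(ℝ, Plane) ∞ M]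

/-- The map is the tangent map of the inverse chart composed with the identification of ℝ² × ℝ² with
the tangent bundle of ℝ². -/
lemma contMDiffOn_tangentPoint {e : OpenPartialHomeomorph M Plane}
    (he : e ∈ IsManifold.maximalAtlas 𝓘(ℝ, Plane) ∞ M) :
    ContMDiffOn 𝓘(ℝ, Plane × Plane) 𝓘(ℝ, Plane).tangent ∞ (tangentPoint e)
      (e.target ×ˢ Set.univ) := by
  have h1 : ContMDiffOn 𝓘(ℝ, Plane).tangent 𝓘(ℝ, Plane).tangent ∞
      (tangentMapWithin 𝓘(ℝ, Plane) 𝓘(ℝ, Plane) e.symm e.target)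
      (Bundle.TotalSpace.proj ⁻¹' e.target) :=
    (contMDiffOn_symm_of_mem_maximalAtlas he).contMDiffOn_tangentMapWithin (by simp)
      e.open_target.uniqueMDiffOn
  have h2 : ContMDiff 𝓘(ℝ, Plane × Plane) 𝓘(ℝ, Plane).tangent ∞
      (fun z : Plane × Plane => (⟨z.1, z.2⟩ : TangentBundle 𝓘(ℝ, Plane) Plane)) := by
    have := contMDiff_tangentBundleModelSpaceHomeomorph_symm (I := 𝓘(ℝ, Plane)) (n := ∞)
    rw [modelWithCornersSelf_prod]
    exact this
  refine (h1.comp h2.contMDiffOn (s := e.target ×ˢ Set.univ) fun z hz => hz.1).congr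
    fun z hz => ?_
  simp only [Function.comp, tangentMapWithin, tangentPoint]
  rw [mfderivWithin_of_isOpen e.open_target hz.1]

variable {e : OpenPartialHomeomorph M Plane} {𝒜 : Set (TangentBundle 𝓘(ℝ, Plane) M)}
  {f : TangentBundle 𝓘(ℝ, Plane) M → ℝ}

lemma isOpen_coordDomain (he : e ∈ IsManifold.maximalAtlas 𝓘(ℝ, Plane) ∞ M) (h𝒜 : IsOpen 𝒜) :
    IsOpen (coordDomain e 𝒜) := by
  have := (contMDiffOn_tangentPoint he).continuousOn.isOpen_inter_preimage
    (e.open_target.prod isOpen_univ) h𝒜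
  convert this using 1
  ext z
  simp [coordDomain]

lemma contDiffOn_inCoord (he : e ∈ IsManifold.maximalAtlas 𝓘(ℝ, Plane) ∞ M)
    (hf : IsSmoothOn 𝒜 f) : ContDiffOn ℝ ∞ (inCoord e f) (coordDomain e 𝒜) :=
  contMDiffOn_iff_contDiffOn.1 <| hf.comp
    ((contMDiffOn_tangentPoint he).mono fun _ hz => ⟨hz.1, Set.mem_univ _⟩) fun _ hz => hz.2

lemma snd_ne_zero (h𝒜 : IsConicSubbundle 𝒜) {z : Plane × Plane} (hz : z ∈ coordDomain e 𝒜) :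
    z.2 ≠ 0 := fun h0 => h𝒜.ne_zero _ hz.2 (by
  simp only [tangentPoint, h0]
  exact map_zero (mfderiv 𝓘(ℝ, Plane) 𝓘(ℝ, Plane) e.symm z.1))

/-- Euler's identity for a positively homogeneous function in natural coordinates. -/
lemma euler_inCoord (he : e ∈ IsManifold.maximalAtlas 𝓘(ℝ, Plane) ∞ M)
    (h𝒜 : IsOpen 𝒜) (hf : IsSmoothOn 𝒜 f) {r : ℕ} (hr : IsPosHomogeneous 𝒜 r f)
    {z : Plane × Plane} (hz : z ∈ coordDomain e 𝒜) :
    z.2 0 * dy 0 (inCoord e f) z + z.2 1 * dy 1 (inCoord e f) z = r * inCoord e f z := by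
  have hd : DifferentiableAt ℝ (inCoord e f) z :=
    ((contDiffOn_inCoord he hf).contDiffAt ((isOpen_coordDomain he h𝒜).mem_nhds hz)).differentiableAt
      (by simp)
  have hy : z.2 = z.2 0 • EuclideanSpace.single 0 1 + z.2 1 • EuclideanSpace.single 1 1 := by
    ext i; fin_cases i <;> simp
  have h1 : fderiv ℝ (inCoord e f) z (0, z.2) =
      z.2 0 * dy 0 (inCoord e f) z + z.2 1 * dy 1 (inCoord e f) z := by
    have : ((0, z.2) : Plane × Plane) = z.2 0 • (0, EuclideanSpace.single 0 1) +
        z.2 1 • (0, EuclideanSpace.single 1 1) := by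
      rw [Prod.smul_mk, Prod.smul_mk, smul_zero, smul_zero, Prod.mk_add_mk, ← hy, zero_add]
    rw [this, map_add, map_smul, map_smul]
    rfl
  rw [← h1]
  -- Along the ray t ↦ ty the function equals tʳ times its value at t = 1; both sides are
  -- differentiated at t = 1.
  have hc : HasDerivAt (fun t : ℝ => (z.1, t • z.2)) (0, z.2) 1 := by
    have := (hasDerivAt_const (1 : ℝ) z.1).prodMk ((hasDerivAt_id (1 : ℝ)).smul_const z.2)
    simpa using this
  have hd' : HasFDerivAt (inCoord e f) (fderiv ℝ (inCoord e f) z) (z.1, (1 : ℝ) • z.2) := by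
    rw [one_smul]; exact hd.hasFDerivAt
  have h2 := hd'.comp_hasDerivAt (1 : ℝ) hc
  have h3 : HasDerivAt (fun t : ℝ => t ^ r * inCoord e f z) (r * inCoord e f z) 1 := by
    simpa using (hasDerivAt_pow r (1 : ℝ)).mul_const (inCoord e f z)
  refine (h2.congr_of_eventuallyEq ?_).unique h3
  filter_upwards [lt_mem_nhds (zero_lt_one' ℝ)] with t ht
  have := hr _ hz.2 t ht
  simp only [Function.comp, inCoord]
  rw [tangentPoint_smul]
  exact this.symm

end Charts

end

end ConicFinsler

/-! ### Vanishing of the Berwald curvature -/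

namespace ConicFinsler

noncomputable section

lemma covector_eq_zero {y v a : Fin 2 → ℝ} (hd : y 0 * v 1 - y 1 * v 0 ≠ 0)
    (hy : y 0 * a 0 + y 1 * a 1 = 0) (hv : v 0 * a 0 + v 1 * a 1 = 0) (i : Fin 2) : a i = 0 := by
  revert i
  rw [Fin.forall_fin_two]
  constructor
  · exact (mul_eq_zero.1 (show (y 0 * v 1 - y 1 * v 0) * a 0 = 0 by
      linear_combination v 1 * hy - y 1 * hv)).resolve_left hd
  · exact (mul_eq_zero.1 (show (y 0 * v 1 - y 1 * v 0) * a 1 = 0 by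
      linear_combination y 0 * hv - v 0 * hy)).resolve_left hd

/-- A symmetric trilinear form on the plane that is annihilated by `y` and vanishes on the
diagonal at `v` is zero. -/
lemma cubic_eq_zero {y v : Fin 2 → ℝ} {τ : Fin 2 → Fin 2 → Fin 2 → ℝ}
    (hd : y 0 * v 1 - y 1 * v 0 ≠ 0) (h1 : ∀ i j k, τ i j k = τ j i k)
    (h2 : ∀ i j k, τ i j k = τ i k j) (hy : ∀ j k, y 0 * τ 0 j k + y 1 * τ 1 j k = 0)
    (hv : ∑ i, ∑ j, ∑ k, v i * v j * v k * τ i j k = 0) (i j k : Fin 2) : τ i j k = 0 := by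
  -- The slots are freed one at a time: a covector that vanishes on both y and v is zero.
  have hv1 : ∀ i, v 0 * (v 0 * τ i 0 0 + v 1 * τ i 0 1) + v 1 * (v 0 * τ i 1 0 + v 1 * τ i 1 1)
      = 0 := by
    refine covector_eq_zero (a := fun i => v 0 * (v 0 * τ i 0 0 + v 1 * τ i 0 1) +
      v 1 * (v 0 * τ i 1 0 + v 1 * τ i 1 1)) hd ?_ ?_
    · linear_combination v 0 ^ 2 * hy 0 0 + v 0 * v 1 * hy 0 1 + v 0 * v 1 * hy 1 0
        + v 1 ^ 2 * hy 1 1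
    · simp only [Fin.sum_univ_two] at hv
      linear_combination hv
  have hv2 : ∀ i j, v 0 * τ i j 0 + v 1 * τ i j 1 = 0 := fun i => by
    refine covector_eq_zero (a := fun j => v 0 * τ i j 0 + v 1 * τ i j 1) hd ?_ (hv1 i)
    simp only [h1 i 0, h1 i 1]
    linear_combination v 0 * hy i 0 + v 1 * hy i 1
  refine covector_eq_zero (a := fun k => τ i j k) hd ?_ (hv2 i j) k
  simp only [h2 i j, h1 i 0, h1 i 1]
  exact hy i j

namespace LocalMetric

open RiemannCalculus

variable {F φ : Plane × Plane → ℝ} {V : Set (Plane × Plane)} {ε₀ : ℝ} (h : LocalMetric F V ε₀)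

lemma wedge_ne_zero (z : V) : (h.calculus.y 0).1 z * (h.calculus.v 1).1 z -
    (h.calculus.y 1).1 z * (h.calculus.v 0).1 z ≠ 0 := by
  rw [← eval_mul, ← eval_mul, ← eval_sub, h.calculus.wedge, eval_mul, eval_pow, h.eval_F]
  refine mul_ne_zero ?_ (pow_ne_zero _ (h.F_ne_zero z))
  change h.sE.1 z ≠ 0
  rw [sE_apply]
  exact inv_ne_zero (Real.sqrt_pos.2 (h.det_pos z z.2)).ne'

/-- G + T solves the system of the new metric, and the solution is unique because a zero determinant
would contradict `det_Wbar`, whose right-hand side w² is invertible. -/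
lemma represents_sprayCoeff_change {f : h.calculus.Factor}
    (hW : Represents (fun z => (Real.exp (φ z) * F z) ^ 2) (2 * f.Wbar)) (i : Fin 2) :
    Represents (sprayCoeff (fun z => Real.exp (φ z) * F z) i) (h.calculus.G i + f.T i) := by
  refine represents_sprayCoeff (hV := h.isOpen) (F := fun z => Real.exp (φ z) * F z) hW
    (fun z hz h0 => ?_) (X := fun i => h.calculus.G i + f.T i) f.spray_Wbar i
  rw [det_metricMatrix (hV := h.isOpen) (F := fun z => Real.exp (φ z) * F z) hW ⟨z, hz⟩] at h0
  have hw := congrFun (congrArg Subtype.val f.w_inv) ⟨z, hz⟩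
  have := congrFun (congrArg Subtype.val f.det_Wbar) ⟨z, hz⟩
  rw [eval_mul, eval_pow] at this
  erw [h0] at this
  rw [zero_mul, eq_comm, sq_eq_zero_iff] at this
  rw [eval_mul, this, zero_mul] at hw
  exact zero_ne_one hw

lemma berwaldCurvature_change {f : h.calculus.Factor}
    (hW : Represents (fun z => (Real.exp (φ z) * F z) ^ 2) (2 * f.Wbar)) (i j k r : Fin 2)
    (z : V) : berwaldCurvature (fun z => Real.exp (φ z) * F z) i j k r z =
      (h.calculus.e r (h.calculus.e k (h.calculus.e j (f.T i)))).1 z := by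
  have h3 := ((((h.represents_sprayCoeff_change hW i).dy (hV := h.isOpen) j).dy
    (hV := h.isOpen) k).dy (hV := h.isOpen) r) z
  refine h3.trans ?_
  change (h.calculus.e r (h.calculus.e k (h.calculus.e j (h.calculus.G i + f.T i)))).1 z = _
  rw [map_add, map_add, map_add, eee_G, zero_add]

/-- By `cubic_eq_zero` the curvature vanishes exactly when its value on (v, v, v) does; as y and v
are independent, this means that both frame components vanish. -/
lemma berwaldCurvature_change_eq_zero_iff {f : h.calculus.Factor}
    (hW : Represents (fun z => (Real.exp (φ z) * F z) ^ 2) (2 * f.Wbar)) (z : V) :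
    (∀ i j k r, berwaldCurvature (fun z => Real.exp (φ z) * F z) i j k r z = 0) ↔
      f.ellComponent.1 z = 0 ∧ f.mComponent.1 z = 0 := by
  simp only [h.berwaldCurvature_change hW]
  have hF := h.F_ne_zero z
  have hd := h.wedge_ne_zero z
  have key : ∀ i, F z * ∑ j, ∑ k, ∑ l, (h.calculus.v j).1 z * (h.calculus.v k).1 z *
      (h.calculus.v l).1 z * (h.calculus.e j (h.calculus.e k (h.calculus.e l (f.T i)))).1 z =
      ε₀ * f.mComponent.1 z * (h.calculus.v i).1 z + f.ellComponent.1 z * (h.calculus.y i).1 z :=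
    fun i => by
      have := congrFun (congrArg Subtype.val (f.F_vvv_T i)) z
      simpa only [Fin.sum_univ_two, eval_mul, eval_add, h.eval_F, h.eval_ε] using this
  constructor
  · intro hB
    have h0 : ∀ i, ε₀ * f.mComponent.1 z * (h.calculus.v i).1 z +
        f.ellComponent.1 z * (h.calculus.y i).1 z = 0 := fun i => by
      rw [← key]; simp [hB]
    have hl : f.ellComponent.1 z = 0 := (mul_eq_zero.1 (show
      ((h.calculus.y 0).1 z * (h.calculus.v 1).1 z - (h.calculus.y 1).1 z * (h.calculus.v 0).1 z) *
        f.ellComponent.1 z = 0 by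
      linear_combination (h.calculus.v 1).1 z * h0 0 - (h.calculus.v 0).1 z * h0 1)).resolve_left hd
    have hm : ε₀ * f.mComponent.1 z = 0 := (mul_eq_zero.1 (show
      ((h.calculus.y 0).1 z * (h.calculus.v 1).1 z - (h.calculus.y 1).1 z * (h.calculus.v 0).1 z) *
        (ε₀ * f.mComponent.1 z) = 0 by
      linear_combination (h.calculus.y 0).1 z * h0 1 - (h.calculus.y 1).1 z * h0 0)).resolve_left hd
    refine ⟨hl, ?_⟩
    linear_combination ε₀ * hm - f.mComponent.1 z * h.sign_sq
  · rintro ⟨hl, hm⟩ i j k r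
    refine cubic_eq_zero (y := fun i => (h.calculus.y i).1 z) (v := fun i => (h.calculus.v i).1 z)
      (τ := fun a b c => (h.calculus.e a (h.calculus.e b (h.calculus.e c (f.T i)))).1 z) hd
      (fun a b c => by simp only [h.calculus.e_comm a b])
      (fun a b c => by simp only [h.calculus.e_comm b c]) (fun a b => ?_) ?_ r k j
    · exact congrFun (congrArg Subtype.val (h.calculus.y_eee (f.Y_T i) a b)) z
    · have := key i
      rw [hl, hm, mul_zero, zero_mul, zero_mul, add_zero] at this
      exact (mul_eq_zero.1 this).resolve_left hF

/-- If the change is projective, then `Q = 0`. -/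
lemma Q_eq_zero {f : h.calculus.Factor}
    (hW : Represents (fun z => (Real.exp (φ z) * F z) ^ 2) (2 * f.Wbar)) {lam : Plane × Plane → ℝ}
    (hlam : ∀ z ∈ V, ∀ i, sprayCoeff (fun z => Real.exp (φ z) * F z) i z =
      sprayCoeff F i z + lam z * z.2 i) : f.Q = 0 := by
  ext z
  have hT : ∀ i, (f.T i).1 z = lam z * (h.calculus.y i).1 z := fun i => by
    have := hlam z z.2 i
    rw [h.represents_sprayCoeff_change hW i z, h.represents_spray i z, eval_add] at this
    exact add_left_cancel this
  -- The wedge of T = λy with y is zero, while by `wedge_T` it is a nonzero multiple of Q.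
  have hw := congrFun (congrArg Subtype.val f.wedge_T) z
  rw [← h.calculus.wedge] at hw
  simp only [eval_mul, eval_sub, hT, h.eval_ε] at hw
  have h0 : (ε₀ * f.Q.1 z) * ((h.calculus.y 0).1 z * (h.calculus.v 1).1 z -
      (h.calculus.y 1).1 z * (h.calculus.v 0).1 z) = 0 := by
    linear_combination -hw
  have h1 := (mul_eq_zero.1 h0).resolve_right (h.wedge_ne_zero z)
  rw [eval_zero]
  linear_combination ε₀ * h1 - f.Q.1 z * h.sign_sq

end LocalMetric

/-- The data of an anisotropic conformal change of a Riemannian metric, in coordinates. -/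
structure LocalChange (F φ : Plane × Plane → ℝ) (U : Set (Plane × Plane)) : Prop where
  isOpen : IsOpen U
  smooth_F : ContDiffOn ℝ ∞ F U
  smooth_φ : ContDiffOn ℝ ∞ φ U
  euler_F : ∀ z ∈ U, z.2 0 * dy 0 F z + z.2 1 * dy 1 F z = F z
  euler_φ : ∀ z ∈ U, z.2 0 * dy 0 φ z + z.2 1 * dy 1 φ z = 0
  dir_ne_zero : ∀ z ∈ U, z.2 ≠ 0
  det_ne_zero : ∀ z ∈ U, (metricMatrix F z).det ≠ 0
  cartan : ∀ z ∈ U, ∀ i j k, cartanTensor F i j k z = 0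
  changeFactor_ne_zero : ∀ z ∈ U, changeFactor F φ z ≠ 0

namespace LocalChange

variable {F φ : Plane × Plane → ℝ} {U : Set (Plane × Plane)}

/-- Around every point there is an open set on which the signature is constant. -/
lemma exists_localMetric (h : LocalChange F φ U) {z : Plane × Plane} (hz : z ∈ U) :
    ∃ (V : Set (Plane × Plane)) (ε₀ : ℝ), z ∈ V ∧ V ⊆ U ∧ LocalMetric F V ε₀ := by
  have hc : ContinuousOn (fun w => (metricMatrix F w).det) U := by
    have hW : Represents (V := U) (fun w => F w ^ 2)
        (2 * (algebraMap ℝ _ (1 / 2) * mkSmooth F h.smooth_F ^ 2)) := by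
      rw [← mul_assoc, LocalMetric.two_half, one_mul]
      exact fun _ => rfl
    exact (contDiffOn_smoothExt _).continuousOn.congr fun w hw =>
      (det_metricMatrix (hV := h.isOpen) hW ⟨w, hw⟩).trans (represents_smoothExt _ ⟨w, hw⟩).symm
  have hε : ∃ ε₀ : ℝ, ε₀ ^ 2 = 1 ∧ 0 < ε₀ * (metricMatrix F z).det := by
    rcases lt_or_gt_of_ne (h.det_ne_zero z hz) with h0 | h0
    · exact ⟨-1, by norm_num, by linarith⟩
    · exact ⟨1, by norm_num, by linarith⟩
  obtain ⟨ε₀, hε, hdet⟩ := hε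
  refine ⟨U ∩ (fun w => ε₀ * (metricMatrix F w).det) ⁻¹' Set.Ioi 0, ε₀, ⟨hz, hdet⟩,
    Set.inter_subset_left, ?_⟩
  exact
    { isOpen := (continuousOn_const.mul hc).isOpen_inter_preimage h.isOpen isOpen_Ioi
      smooth := h.smooth_F.mono Set.inter_subset_left
      euler := fun w hw => h.euler_F w hw.1
      dir_ne_zero := fun w hw => h.dir_ne_zero w hw.1
      sign_sq := hε
      det_pos := fun w hw => hw.2
      cartan := fun w hw => h.cartan w hw.1 }

/-- The pointwise characterization of the vanishing of the Berwald curvature of `e^φ F`. -/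
lemma berwaldCurvature_eq_zero_iff (h : LocalChange F φ U) {z : Plane × Plane} (hz : z ∈ U) :
    (∀ i j k r, berwaldCurvature (fun z => Real.exp (φ z) * F z) i j k r z = 0) ↔
      -3 * eps F z * Q F φ z - 3 * vDeriv2 F (vDeriv2 F (Q F φ)) z + eps F z * vDeriv2 F (P F φ) z
        + vDeriv2 F (vDeriv2 F (vDeriv2 F (P F φ))) z = 0 ∧
      3 * P F φ z + 3 * eps F z * vDeriv2 F (vDeriv2 F (P F φ)) z + eps F z * vDeriv2 F (Q F φ) z
        + vDeriv2 F (vDeriv2 F (vDeriv2 F (Q F φ))) z = 0 := by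
  obtain ⟨V, ε₀, hzV, hVU, hm⟩ := h.exists_localMetric hz
  obtain ⟨f, -, hQ, hP, hW⟩ := hm.exists_factor (h.smooth_φ.mono hVU)
    (fun w hw => h.euler_φ w (hVU hw)) (fun w hw => h.changeFactor_ne_zero w (hVU hw))
  rw [hm.berwaldCurvature_change_eq_zero_iff hW ⟨z, hzV⟩]
  have hQ1 := hm.represents_vDeriv2 hQ
  have hQ2 := hm.represents_vDeriv2 hQ1
  have hQ3 := hm.represents_vDeriv2 hQ2
  have hP1 := hm.represents_vDeriv2 hP
  have hP2 := hm.represents_vDeriv2 hP1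
  have hP3 := hm.represents_vDeriv2 hP2
  have e := hm.eps_eq ⟨z, hzV⟩
  rw [e, hQ ⟨z, hzV⟩, hQ1 ⟨z, hzV⟩, hQ2 ⟨z, hzV⟩, hQ3 ⟨z, hzV⟩, hP ⟨z, hzV⟩, hP1 ⟨z, hzV⟩,
    hP2 ⟨z, hzV⟩, hP3 ⟨z, hzV⟩]
  rfl

/-- The characterization for projectively equivalent sprays. -/
lemma berwaldCurvature_eq_zero_iff_of_projective (h : LocalChange F φ U) {lam : Plane × Plane → ℝ}
    (hlam : ∀ z ∈ U, ∀ i, sprayCoeff (fun z => Real.exp (φ z) * F z) i z =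
      sprayCoeff F i z + lam z * z.2 i) :
    (∀ z ∈ U, ∀ i j k r, berwaldCurvature (fun z => Real.exp (φ z) * F z) i j k r z = 0) ↔
      ∀ z ∈ U, hDeriv1 F φ z + eps F z * vDeriv2 F (vDeriv2 F (hDeriv1 F φ)) z = 0 := by
  constructor
  · intro hB z hz
    obtain ⟨V, ε₀, hzV, hVU, hm⟩ := h.exists_localMetric hz
    obtain ⟨f, hφ, -, -, hW⟩ := hm.exists_factor (h.smooth_φ.mono hVU)
      (fun w hw => h.euler_φ w (hVU hw)) (fun w hw => h.changeFactor_ne_zero w (hVU hw))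
    have h1 := hm.represents_hDeriv1 hφ
    have h2 := hm.represents_vDeriv2 (hm.represents_vDeriv2 h1)
    have hc := (hm.berwaldCurvature_change_eq_zero_iff hW ⟨z, hzV⟩).1 (hB z hz)
    have ht := congrFun (congrArg Subtype.val (f.two_mComponent
      (hm.Q_eq_zero hW fun w hw => hlam w (hVU hw)))) ⟨z, hzV⟩
    rw [eval_mul, hc.2, mul_zero, eval_mul, eval_mul, eval_pow, hm.eval_F] at ht
    rw [hm.eps_eq ⟨z, hzV⟩, h1 ⟨z, hzV⟩, h2 ⟨z, hzV⟩]
    refine (mul_eq_zero.1 ht.symm).resolve_left ?_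
    exact mul_ne_zero three_ne_zero (pow_ne_zero _ (hm.F_ne_zero ⟨z, hzV⟩))
  · intro hc z hz
    obtain ⟨V, ε₀, hzV, hVU, hm⟩ := h.exists_localMetric hz
    obtain ⟨f, hφ, -, -, hW⟩ := hm.exists_factor (h.smooth_φ.mono hVU)
      (fun w hw => h.euler_φ w (hVU hw)) (fun w hw => h.changeFactor_ne_zero w (hVU hw))
    have h1 := hm.represents_hDeriv1 hφ
    have h2 := hm.represents_vDeriv2 (hm.represents_vDeriv2 h1)
    have hQ := hm.Q_eq_zero hW fun w hw => hlam w (hVU hw)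
    -- The condition is needed as an identity on all of V, because the ℓ-component involves its
    -- derivative.
    have hzero : hm.calculus.h1 f.φ + hm.calculus.ε *
        hm.calculus.D (hm.calculus.D (hm.calculus.h1 f.φ)) = 0 := by
      ext w
      have := hc w (hVU w.2)
      rw [hm.eps_eq w, h1 w, h2 w] at this
      exact this
    have hM : f.mComponent = 0 := RiemannCalculus.two_cancel (by
      rw [f.two_mComponent hQ, hzero]; ring)
    have hL : f.ellComponent = 0 := RiemannCalculus.two_cancel (by
      rw [f.two_ellComponent hQ, hzero, map_zero]; ring)
    refine (hm.berwaldCurvature_change_eq_zero_iff hW ⟨z, hzV⟩).2 ⟨?_, ?_⟩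
    · rw [hL]; rfl
    · rw [hM]; rfl

end LocalChange

lemma localChange_inCoord {M : Type*} [TopologicalSpace M] [ChartedSpace Plane M]
    [IsManifold 𝓘(ℝ, Plane) ∞ M] {𝒜 : Set (TangentBundle 𝓘(ℝ, Plane) M)}
    {F φ : TangentBundle 𝓘(ℝ, Plane) M → ℝ} (hF : IsConicPseudoFinsler 𝒜 F)
    (hR : IsPseudoRiemannian 𝒜 F) (hφ : IsAnisotropicFactor 𝒜 F φ)
    {e : OpenPartialHomeomorph M Plane} (he : e ∈ IsManifold.maximalAtlas 𝓘(ℝ, Plane) ∞ M) :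
    LocalChange (inCoord e F) (inCoord e φ) (coordDomain e 𝒜) where
  isOpen := isOpen_coordDomain he hF.subbundle.isOpen
  smooth_F := contDiffOn_inCoord he hF.smooth
  smooth_φ := contDiffOn_inCoord he hφ.smooth
  euler_F z hz := by
    simpa using euler_inCoord he hF.subbundle.isOpen hF.smooth hF.homogeneous hz
  euler_φ z hz := by
    simpa using euler_inCoord he hF.subbundle.isOpen hφ.smooth hφ.homogeneous hz
  dir_ne_zero z hz := snd_ne_zero hF.subbundle hz
  det_ne_zero z hz := hF.nondegenerate e he z hz
  cartan z hz := hR e he z hz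
  changeFactor_ne_zero z hz := hφ.changeFactor_ne_zero e he z hz

end

end ConicFinsler

theorem mainTheorem1 {M : Type*} [TopologicalSpace M] [ChartedSpace ConicFinsler.Plane M]
    [IsManifold 𝓘(ℝ, ConicFinsler.Plane) ∞ M]
    (𝒜 : Set (TangentBundle 𝓘(ℝ, ConicFinsler.Plane) M))
    (F φ : TangentBundle 𝓘(ℝ, ConicFinsler.Plane) M → ℝ)
    (hF : ConicFinsler.IsConicPseudoFinsler 𝒜 F)
    (hR : ConicFinsler.IsPseudoRiemannian 𝒜 F)
    (hφ : ConicFinsler.IsAnisotropicFactor 𝒜 F φ) :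
    (ConicFinsler.IsBerwald 𝒜 (ConicFinsler.conformalChange F φ) ↔
      ConicFinsler.EverywhereInCoord 𝒜 fun e z =>
        let Fe := ConicFinsler.inCoord e F
        let P := ConicFinsler.P Fe (ConicFinsler.inCoord e φ)
        let Q := ConicFinsler.Q Fe (ConicFinsler.inCoord e φ)
        let ε := ConicFinsler.eps Fe z
        let D := ConicFinsler.vDeriv2 Fe;
        -3 * ε * Q z - 3 * D (D Q) z + ε * D P z + D (D (D P)) z = 0 ∧
        3 * P z + 3 * ε * D (D P) z + ε * D Q z + D (D (D Q)) z = 0) ∧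
    (ConicFinsler.ProjectivelyEquivalent 𝒜 F (ConicFinsler.conformalChange F φ) →
      (ConicFinsler.IsBerwald 𝒜 (ConicFinsler.conformalChange F φ) ↔
        ConicFinsler.EverywhereInCoord 𝒜 fun e z =>
          let Fe := ConicFinsler.inCoord e F
          let φ₁ := ConicFinsler.hDeriv1 Fe (ConicFinsler.inCoord e φ)
          let D := ConicFinsler.vDeriv2 Fe
          φ₁ z + ConicFinsler.eps Fe z * D (D φ₁) z = 0)) := by
  refine ⟨forall₂_congr fun e he => forall₂_congr fun z hz =>
    (ConicFinsler.localChange_inCoord hF hR hφ he).berwaldCurvature_eq_zero_iff hz, ?_⟩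
  rintro ⟨lam, hlam⟩
  exact forall₂_congr fun e he => (ConicFinsler.localChange_inCoord hF hR hφ
    he).berwaldCurvature_eq_zero_iff_of_projective (lam := ConicFinsler.inCoord e lam)
      fun z hz => hlam e he z hz
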